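/- Let $d\ge 1$ be an integer, $-d<\gamma<0$ and $1<p<\infty$. Write $\langle v\rangle=\sqrt{1+|v|^2}$, let $\mathcal M(v)=(2\pi)^{-d/2}e^{-|v|^2/2}$ on $\mathbb R^d$, and for a measurable $b$, even and non-negative on $[-1,1]$, with $\int_{\mathbb S^{d-1}}b(e\cdot\sigma)\,d\sigma=1$ for unit vectors $e$ ($d\sigma$ being surface measure), let $$\bm L_\gamma f(v)=\int_{\mathbb R^d\times\mathbb S^{d-1}}|v-v_*|^\gamma\, b(\cos\theta)\,\bigl(f(v')\mathcal M(v_*')-f(v)\mathcal M(v_*)\bigr)\,dv_*\,d\sigma,$$ $$v'=\tfrac{v+v_*}2+\tfrac{|v-v_*|}2\sigma,\qquad v_*'=\tfrac{v+v_*}2-\tfrac{|v-v_*|}2\sigma,\qquad \cos\theta=\tfrac{v-v_*}{|v-v_*|}\cdot\sigma .$$ Set $$\eta_0=\min\left\{p-1,\ \frac{(p-1)^2}{(2-p)^+},\ \frac{p^2}{\sqrt{\frac1{(p-1)^2}+p^2}+\frac1{p-1}},\ \frac{p^2}{\sqrt{\frac1{(1+\gamma/d)^2}+p^2}+\frac1{1+\gamma/d}}\right\}$$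 (the second entry being $+\infty$ if $p\ge2$), and for $0<\eta<\eta_0$ $$\bm r=\bm r(\eta)=\frac{|\gamma|}{\eta}\max\bigl\{p-1-\eta,\ (p+\eta)(p-2)+1\bigr\}.$$ **Theorem.** (i) There is $\eta\in(0,\eta_0)$ with $\bm r(\eta)>1$. (ii) For every $\eta\in(0,\eta_0)$ there is a constant $C\ge 0$, depending only on $p,d,\gamma$ and $\eta$, such that for every $b$ as above, every $f_0\in L^1(\mathbb R^d)\cap L^p(\mathbb R^d)$ and every non-negative mild solution $f\in C([0,\infty);L^1(\mathbb R^d))$ of $\partial_t f=\bm L_\gamma f$, $f(0)=f_0$ (that is, $f(t)=f_0+\bm L_\gamma\int_0^tf(\tau)\,d\tau$ for all $t\ge0$), one has for all $t\ge 0$ $$\|f(t)\|_p^p\le\|f_0\|_p^p+C\int_0^t M_{\bm r}(\tau)^p\,d\tau,\qquad M_{\bm r}(\tau)=\int_{\mathbb R^d}\langle v\rangle^{\bm r}f(\tau,v)\,dv\in[0,\infty],$$ as an inequality in $[0,\infty]$. In particular it holds for some $\bm r>1$ and a constant depending only on $p,d,\gamma$. -/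

import Mathlib

open MeasureTheory Set

noncomputable section

namespace LinearBoltzmann

/-- Velocity space `ℝᵈ` with the Euclidean norm. -/
abbrev Vel (d : ℕ) : Type := EuclideanSpace ℝ (Fin d)

/-- The unit sphere of `ℝᵈ`. -/
abbrev Sph (d : ℕ) : Type := Metric.sphere (0 : Vel d) 1

/-- The surface measure on the unit sphere. -/
abbrev sphMeasure (d : ℕ) : Measure (Sph d) := (volume : Measure (Vel d)).toSphere

/-- The normalised Maxwellian `(2π)^(-d/2) exp(-|v|²/2)`. -/
def maxwellian (d : ℕ) (v : Vel d) : ℝ :=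
  1 / (2 * Real.pi) ^ ((d : ℝ) / 2) * Real.exp (-‖v‖ ^ 2 / 2)

/-- The pre-collisional velocity `v'`. -/
def vPrime {d : ℕ} (v w : Vel d) (σ : Sph d) : Vel d :=
  (1 / 2 : ℝ) • (v + w) + (‖v - w‖ / 2) • (σ : Vel d)

/-- The pre-collisional velocity `v'_*`. -/
def vStarPrime {d : ℕ} (v w : Vel d) (σ : Sph d) : Vel d :=
  (1 / 2 : ℝ) • (v + w) - (‖v - w‖ / 2) • (σ : Vel d)

/-- The cosine of the deviation angle, `(v - v_*)/|v - v_*| · σ`. -/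
def cosTheta {d : ℕ} (v w : Vel d) (σ : Sph d) : ℝ :=
  inner ℝ (‖v - w‖⁻¹ • (v - w)) (σ : Vel d)

/-- An angular kernel satisfying Grad's cut-off assumption, normalised to unit mass on the
sphere: measurable, even and non-negative on `[-1,1]`, with
`∫ b(e · σ) dσ = 1` (by rotation invariance the integral does not depend on the unit vector `e`).
Only the values of `b` on `[-1,1]` matter. -/
structure IsAngularKernel (d : ℕ) (b : ℝ → ℝ) : Prop where
  measurable : Measurable b
  nonneg : ∀ s ∈ Icc (-1 : ℝ) 1, 0 ≤ b s
  even : ∀ s ∈ Icc (-1 : ℝ) 1, b (-s) = b s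
  mass : ∀ e : Sph d,
    ∫⁻ σ, ENNReal.ofReal (b (inner ℝ (e : Vel d) (σ : Vel d))) ∂(sphMeasure d) = 1

/-- The bilinear collision operator `𝒬_γ(f, g)` with kernel `|v - v_*|^γ b(cos θ)`. -/
def collision {d : ℕ} (γ : ℝ) (b : ℝ → ℝ) (f g : Vel d → ℝ) (v : Vel d) : ℝ :=
  ∫ x : Vel d × Sph d,
    ‖v - x.1‖ ^ γ * b (cosTheta v x.1 x.2) *
      (f (vPrime v x.1 x.2) * g (vStarPrime v x.1 x.2) - f v * g x.1)
    ∂((volume : Measure (Vel d)).prod (sphMeasure d))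

/-- The linear Boltzmann operator `L_γ f = 𝒬_γ(f, ℳ)`. -/
def linearBoltzmann {d : ℕ} (γ : ℝ) (b : ℝ → ℝ) (f : Vel d → ℝ) : Vel d → ℝ :=
  collision γ b f (maxwellian d)

/-- `f : [0,∞) → L¹(ℝᵈ)` is the mild solution of `∂ₜ f = L_γ f`, `f(0) = f₀`: it is continuous
with values in `L¹` and satisfies `f(t) = f₀ + L_γ (∫₀ᵗ f(τ) dτ)` for all `t ≥ 0`, where the time
integral is taken in `L¹`. As `L_γ` is bounded on `L¹`, this is the same as `f(t) = U(t) f₀`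
for the semigroup `U` generated by `L_γ`. Values of `f` at negative times play no role. -/
structure IsMildSolution {d : ℕ} (γ : ℝ) (b : ℝ → ℝ) (f₀ : Vel d → ℝ)
    (f : ℝ → Lp ℝ 1 (volume : Measure (Vel d))) : Prop where
  continuousOn : ContinuousOn f (Ici 0)
  initial : f 0 =ᵐ[volume] f₀
  equation : ∀ t : ℝ, 0 ≤ t →
    f t =ᵐ[volume] fun v => f₀ v +
      linearBoltzmann γ b ((∫ τ in (0 : ℝ)..t, f τ : Lp ℝ 1 (volume : Measure (Vel d))) : Vel d → ℝ) v

/-- The generalised moment `M_k(g) = ∫ ⟨v⟩^k g(v) dv ∈ [0,∞]` of a non-negative function `g`,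
where `⟨v⟩ = √(1 + |v|²)`. -/
def moment {d : ℕ} (k : ℝ) (g : Vel d → ℝ) : ENNReal :=
  ∫⁻ v, ENNReal.ofReal (Real.sqrt (1 + ‖v‖ ^ 2) ^ k * g v)

/-- For `a > 0`, the quantity `p² / (√(1/a² + p²) + 1/a)`. -/
def etaBound (p a : ℝ) : ℝ := p ^ 2 / (Real.sqrt (1 / a ^ 2 + p ^ 2) + 1 / a)

/-- The threshold `η₀`, the minimum of `p - 1`, `(p-1)²/(2-p)⁺` (which is `+∞` for `p ≥ 2`),
`etaBound p (p-1)` and `etaBound p (1 + γ/d)`. -/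
def eta0 (d : ℕ) (γ p : ℝ) : ℝ :=
  let m := min (p - 1) (min (etaBound p (p - 1)) (etaBound p (1 + γ / d)))
  if p < 2 then min m ((p - 1) ^ 2 / (2 - p)) else m

/-- The order of the moment,
`r = (|γ|/η) max (p - 1 - η, (p + η)(p - 2) + 1)`. -/
def momentOrder (γ p η : ℝ) : ℝ :=
  |γ| / η * max (p - 1 - η) ((p + η) * (p - 2) + 1)

end LinearBoltzmann

end

open LinearBoltzmann

/-! Along a solution the $L^p$ functional grows at most like the $p$-th power of the mass: its
derivative is bounded by $C\|f\|_1^p$. A moment of non-negative order dominates the mass, and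
$\eta<\eta_0\le p-1$ forces $\bm r(\eta)\ge 0$, so this is enough. Part (i) holds because $\bm
r(\eta)\to\infty$ as $\eta\to0$.

To bound the derivative, write the gain term as $\iiint |v-v_*|^\gamma b\,\varphi(v)f(v')\mathcal
M(v_*')$ with $\varphi=pf^{p-1}$, and use Young's inequality $\varphi(x)f(y)\le\beta(y)+G(x)$ with
$\beta=f^p$, $G=(p-1)f^p$. Since $\beta+G=\varphi f$, the loss term is exactly $\int(\beta+G)\nu$,
where $\nu$ is the collision frequency. The pre-post-collisional change of variables turns the
$\beta$ term into $\int\beta\nu$ times the angular mass. The $G$ term requires the change of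
variables $u\mapsto v-v_*'=(u+|u|\sigma)/2$, singular at $\sigma=-u/|u|$. Collisions are split in
three: grazing ones, where the Jacobian costs at most $3/2$ while evenness of $b$ leaves at most
half of the angular mass, giving $3/4$; non-grazing ones with small relative speed, contributing at
most $1/8$ by local integrability of $|u|^\gamma$; the others, where $u\mapsto v-v'=(u-|u|\sigma)/2$
is non-singular and bounds the integral of $f(v')G(v)$ by $\|f\|_1\int G\nu$. In the last group
$\varphi\le hG+h^{-(p-1)}$, with $h$ of order $1/\|f\|_1$, uses the remaining $1/8$ and leaves
$C\|f\|_1^p$. This is `exists_gainForm_le` and `gain_le_loss_add`.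

Constants are independent of $b$ because $w(\omega\cdot\sigma)\,d\omega\,d\sigma$, pushed forward by
a rotation-equivariant map, is controlled by surface measure with only the total angular mass as
factor (`lintegral_equivariant_le`).

As $f(t)$ is only known to be in $L^1$, $s^p$ is replaced by its tangent beyond $n$. This convex
function has a bounded derivative and satisfies the same Young inequality, so the estimate passes to
mild solutions (`truncFunctional_le`) uniformly in $n$; then $n\to\infty$. -/

noncomputable section

namespace LinearBoltzmann

open scoped ENNReal NNReal Topology Pointwise
open Filter

/-! ### Rotation invariance on the sphere and push-forwards by equivariant maps. -/

section Sphere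

variable {d : ℕ}

/-- The action of a linear isometry on the unit sphere. -/
def sphMap (R : Vel d ≃ₗᵢ[ℝ] Vel d) (x : Sph d) : Sph d :=
  ⟨R x, by simp [R.norm_map]⟩

@[simp] lemma coe_sphMap (R : Vel d ≃ₗᵢ[ℝ] Vel d) (x : Sph d) : (sphMap R x : Vel d) = R x := rfl

lemma continuous_sphMap (R : Vel d ≃ₗᵢ[ℝ] Vel d) : Continuous (sphMap R) :=
  Continuous.subtype_mk (R.continuous.comp continuous_subtype_val) _

/-- Surface measure is the normalised volume of the cone over a set, and `R` preserves both volume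
and cones. -/
lemma measurePreserving_sphMap (R : Vel d ≃ₗᵢ[ℝ] Vel d) :
    MeasurePreserving (sphMap R) (sphMeasure d) (sphMeasure d) := by
  refine ⟨(continuous_sphMap R).measurable, ?_⟩
  ext s hs
  rw [Measure.map_apply (continuous_sphMap R).measurable hs,
    Measure.toSphere_apply' _ ((continuous_sphMap R).measurable hs), Measure.toSphere_apply' _ hs]
  congr 1
  have key : R ⁻¹' (Ioo (0 : ℝ) 1 • ((↑) '' s : Set (Vel d))) =
      Ioo (0 : ℝ) 1 • ((↑) '' (sphMap R ⁻¹' s) : Set (Vel d)) := by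
    ext x
    simp only [mem_preimage, Set.mem_smul, mem_image]
    constructor
    · rintro ⟨r, hr, _, ⟨y, hy, rfl⟩, h⟩
      refine ⟨r, hr, _, ⟨sphMap R.symm y, ?_, rfl⟩, ?_⟩
      · have : sphMap R (sphMap R.symm y) = y := by ext1; simp
        simpa [mem_preimage, this] using hy
      · apply R.injective
        simp [h]
    · rintro ⟨r, hr, _, ⟨y, hy, rfl⟩, h⟩
      exact ⟨r, hr, _, ⟨_, hy, rfl⟩, by simp [← h]⟩
  rw [← key]
  exact (R.measurePreserving).measure_preimage_emb R.toHomeomorph.measurableEmbedding _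

/-- The reflection in the hyperplane orthogonal to `x - y` exchanges two vectors of equal norm. -/
lemma exists_sphMap_eq (x y : Sph d) : ∃ R : Vel d ≃ₗᵢ[ℝ] Vel d, sphMap R x = y := by
  refine ⟨(Submodule.span ℝ {(x : Vel d) - y})ᗮ.reflection, ?_⟩
  ext1
  simpa using Submodule.reflection_sub (F := Vel d) (v := x) (w := y) (by simp)

/-- The integral over the sphere of a zonal function does not depend on its axis. -/
lemma lintegral_zonal (k : ℝ → ℝ≥0∞) (x y : Sph d) :
    ∫⁻ σ, k (inner ℝ (x : Vel d) (σ : Vel d)) ∂sphMeasure d =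
      ∫⁻ σ, k (inner ℝ (y : Vel d) (σ : Vel d)) ∂sphMeasure d := by
  obtain ⟨R, rfl⟩ := exists_sphMap_eq x y
  rw [← (measurePreserving_sphMap R).lintegral_comp_emb
    (f := fun σ : Sph d => k (inner ℝ ((sphMap R x : Sph d) : Vel d) (σ : Vel d)))
    (g := sphMap R)]
  · simp [R.inner_map_map]
  · let e : Sph d ≃ Sph d := ⟨sphMap R, sphMap R.symm, fun x => by ext1; simp,
      fun x => by ext1; simp⟩
    exact (MeasurableEquiv.mk e (continuous_sphMap R).measurable
      (continuous_sphMap R.symm).measurable).measurableEmbedding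

lemma lintegral_sphMap (R : Vel d ≃ₗᵢ[ℝ] Vel d) (F : Sph d → ℝ≥0∞) :
    ∫⁻ σ, F (sphMap R σ) ∂sphMeasure d = ∫⁻ σ, F σ ∂sphMeasure d := by
  refine (measurePreserving_sphMap R).lintegral_comp_emb ?_ F
  let e : Sph d ≃ Sph d := ⟨sphMap R, sphMap R.symm, fun x => by ext1; simp,
    fun x => by ext1; simp⟩
  exact (MeasurableEquiv.mk e (continuous_sphMap R).measurable
    (continuous_sphMap R.symm).measurable).measurableEmbedding

/-- A map of two points of the sphere which commutes with all linear isometries. -/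
structure IsEquivariant (E : Sph d → Sph d → Sph d) : Prop where
  measurable : Measurable fun q : Sph d × Sph d => E q.1 q.2
  map : ∀ (R : Vel d ≃ₗᵢ[ℝ] Vel d) x y, E (sphMap R x) (sphMap R y) = sphMap R (E x y)

variable {E : Sph d → Sph d → Sph d} {w : ℝ → ℝ≥0∞} {m : ℝ≥0∞}

lemma measurable_weight (hw : Measurable w) :
    Measurable fun q : Sph d × Sph d => w (inner ℝ (q.1 : Vel d) (q.2 : Vel d)) := by
  fun_prop

lemma measurable_zonal (hw : Measurable w) (e : Sph d) :
    Measurable fun σ : Sph d => w (inner ℝ (e : Vel d) (σ : Vel d)) := by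
  fun_prop

/-- The mass of the push-forward of `w(ω·σ) dω dσ` under an equivariant map near a point. -/
lemma lintegral_equivariant_ball (hE : IsEquivariant E) (hw : Measurable w)
    (hm : ∀ e : Sph d, ∫⁻ σ, w (inner ℝ (e : Vel d) (σ : Vel d)) ∂sphMeasure d = m)
    (k : ℝ → ℝ≥0∞) (hk : Measurable k) (y : Sph d) :
    ∫⁻ ω, ∫⁻ σ, w (inner ℝ (ω : Vel d) (σ : Vel d)) * k (inner ℝ (y : Vel d) (E ω σ : Vel d))
        ∂sphMeasure d ∂sphMeasure d =
      m * ∫⁻ σ, k (inner ℝ (y : Vel d) (σ : Vel d)) ∂sphMeasure d := by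
  have hEm := hE.measurable
  set I : Sph d → ℝ≥0∞ := fun y => ∫⁻ ω, ∫⁻ σ, w (inner ℝ (ω : Vel d) (σ : Vel d)) *
    k (inner ℝ (y : Vel d) (E ω σ : Vel d)) ∂sphMeasure d ∂sphMeasure d with hI
  have hconst : ∀ z, I z = I y := by
    intro z
    obtain ⟨R, rfl⟩ := exists_sphMap_eq y z
    simp only [hI]
    rw [← lintegral_sphMap R]
    refine lintegral_congr fun ω => ?_
    rw [← lintegral_sphMap R]
    refine lintegral_congr fun σ => ?_
    rw [hE.map]
    simp [R.inner_map_map]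
  set A := ∫⁻ σ, k (inner ℝ (y : Vel d) (σ : Vel d)) ∂sphMeasure d with hA
  -- Averaging the constant `I` over the base point and exchanging integrals puts the integral in
  -- `z` innermost, where zonality evaluates it independently of `E ω σ`.
  have h1 : ∫⁻ z, I z ∂sphMeasure d = sphMeasure d univ * (m * A) := by
    simp only [hI]
    have hq : Measurable fun q : Sph d × Sph d × Sph d =>
        w (inner ℝ (q.2.1 : Vel d) (q.2.2 : Vel d)) *
          k (inner ℝ (q.1 : Vel d) (E q.2.1 q.2.2 : Vel d)) := by
      refine ((measurable_weight hw).comp measurable_snd).mul ?_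
      have : Measurable fun q : Sph d × Sph d × Sph d => (E q.2.1 q.2.2 : Vel d) :=
        measurable_subtype_coe.comp (hEm.comp measurable_snd)
      fun_prop
    calc _ = ∫⁻ ω, ∫⁻ z, ∫⁻ σ, w (inner ℝ (ω : Vel d) (σ : Vel d)) *
            k (inner ℝ (z : Vel d) (E ω σ : Vel d))
            ∂sphMeasure d ∂sphMeasure d ∂sphMeasure d := by
          refine lintegral_lintegral_swap ?_
          exact (Measurable.lintegral_prod_right' (f := fun q : (Sph d × Sph d) × Sph d =>
            w (inner ℝ (q.1.2 : Vel d) (q.2 : Vel d)) *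
            k (inner ℝ (q.1.1 : Vel d) (E q.1.2 q.2 : Vel d)))
            (hq.comp (by fun_prop : Measurable fun q : (Sph d × Sph d) × Sph d =>
              (q.1.1, q.1.2, q.2)))).aemeasurable
      _ = ∫⁻ ω, ∫⁻ σ, w (inner ℝ (ω : Vel d) (σ : Vel d)) * A
            ∂sphMeasure d ∂sphMeasure d := by
          refine lintegral_congr fun ω => ?_
          rw [lintegral_lintegral_swap]
          · refine lintegral_congr fun σ => ?_
            rw [lintegral_const_mul _ (by fun_prop)]
            congr 1
            simp_rw [fun z : Sph d => real_inner_comm (E ω σ : Vel d) (z : Vel d)]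
            exact lintegral_zonal k _ _
          · exact (hq.comp (by fun_prop : Measurable fun q : Sph d × Sph d =>
              (q.1, ω, q.2))).aemeasurable
      _ = _ := by
          have : ∀ ω : Sph d, ∫⁻ σ, w (inner ℝ (ω : Vel d) (σ : Vel d)) * A ∂sphMeasure d =
              m * A := fun ω => by
            rw [lintegral_mul_const _ (measurable_zonal hw ω), hm]
          rw [lintegral_congr this, lintegral_const, mul_comm]
  simp_rw [hconst] at h1
  rw [lintegral_const, mul_comm] at h1
  have h0 : sphMeasure d univ ≠ 0 := by
    have : Nonempty (Sph d) := ⟨y⟩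
    exact isOpen_univ.measure_ne_zero _ univ_nonempty
  exact (ENNReal.mul_right_inj h0 (measure_ne_top _ _)).1 h1

/-- The push-forward of `w(ω·σ) dω dσ` under an equivariant map is bounded by a multiple of the
surface measure. -/
lemma lintegral_equivariant_le (hE : IsEquivariant E) (hw : Measurable w)
    (hm : ∀ e : Sph d, ∫⁻ σ, w (inner ℝ (e : Vel d) (σ : Vel d)) ∂sphMeasure d = m)
    (hmt : m ≠ ∞) (H : Sph d → ℝ≥0∞) (hH : Measurable H) :
    ∫⁻ ω, ∫⁻ σ, w (inner ℝ (ω : Vel d) (σ : Vel d)) * H (E ω σ) ∂sphMeasure d ∂sphMeasure d ≤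
      m * ∫⁻ σ, H σ ∂sphMeasure d := by
  have hEm := hE.measurable
  set W : Measure (Sph d × Sph d) := ((sphMeasure d).prod (sphMeasure d)).withDensity
    fun q => w (inner ℝ (q.1 : Vel d) (q.2 : Vel d)) with hW
  set μ : Measure (Sph d) := W.map fun q => E q.1 q.2 with hμ
  have hμH : ∀ H : Sph d → ℝ≥0∞, Measurable H → ∫⁻ x, H x ∂μ =
      ∫⁻ ω, ∫⁻ σ, w (inner ℝ (ω : Vel d) (σ : Vel d)) * H (E ω σ)
        ∂sphMeasure d ∂sphMeasure d := by
    intro H hH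
    have := (measurable_weight (d := d) hw).mul (hH.comp hEm)
    rw [hμ, lintegral_map hH hEm, hW]
    refine (lintegral_withDensity_eq_lintegral_mul _ (measurable_weight hw) (hH.comp hEm)).trans ?_
    rw [lintegral_prod _ this.aemeasurable]
    rfl
  rw [← hμH H hH, ← smul_eq_mul, ← lintegral_smul_measure]
  refine lintegral_mono' ?_ le_rfl
  -- balls
  have hball : ∀ (y : Sph d) (r : ℝ), μ (Metric.ball y r) = m * sphMeasure d (Metric.ball y r) := by
    intro y r
    -- On the unit sphere $|x-y|^2=2-2\,x\cdot y$, so the indicator of a ball is zonal about its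
    -- centre.
    set k : ℝ → ℝ≥0∞ := indicator {s | Real.sqrt (2 - 2 * s) < r} 1 with hk
    have hkm : Measurable k :=
      measurable_one.indicator (measurableSet_lt (by fun_prop) measurable_const)
    have hind : ∀ x : Sph d, (Metric.ball y r).indicator 1 x =
        k (inner ℝ (y : Vel d) (x : Vel d)) := by
      intro x
      have : dist x y = Real.sqrt (2 - 2 * inner ℝ (y : Vel d) (x : Vel d)) := by
        rw [Subtype.dist_eq, dist_eq_norm, ← Real.sqrt_sq (norm_nonneg _), norm_sub_sq_real]
        congr 1
        have h1 : ‖(x : Vel d)‖ = 1 := by simp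
        have h2 : ‖(y : Vel d)‖ = 1 := by simp
        rw [h1, h2, real_inner_comm]
        ring
      simp only [hk, indicator, Metric.mem_ball, mem_ofPred_eq, this]
      rfl
    rw [← lintegral_indicator_one Metric.isOpen_ball.measurableSet,
      ← lintegral_indicator_one Metric.isOpen_ball.measurableSet,
      hμH _ (measurable_one.indicator Metric.isOpen_ball.measurableSet)]
    simp_rw [hind]
    exact lintegral_equivariant_ball hE hw hm k hkm y
  -- open sets
  have hopen : ∀ U : Set (Sph d), IsOpen U → μ U ≤ m * sphMeasure d U := by
    intro U hU
    rcases isEmpty_or_nonempty (Sph d) with hemp | ⟨⟨y0⟩⟩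
    · simp [Set.eq_empty_of_isEmpty U]
    set r : ℕ → ℝ := fun n => 1 / ((n : ℝ) + 1) with hr
    have hr0 : ∀ n, 0 < r n := fun n => by positivity
    have hτ : ∀ (n : ℕ) (x : Sph d), sphMeasure d (Metric.ball x (r n)) =
        sphMeasure d (Metric.ball y0 (r n)) := by
      intro n x
      obtain ⟨R, rfl⟩ := exists_sphMap_eq x y0
      rw [← (measurePreserving_sphMap R).measure_preimage (s := Metric.ball (sphMap R x) (r n))
        Metric.isOpen_ball.measurableSet.nullMeasurableSet]
      congr 1
      ext z
      simp [Subtype.dist_eq]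
    set a : ℕ → ℝ≥0∞ := fun n => sphMeasure d (Metric.ball y0 (r n)) with ha
    have ha0 : ∀ n, a n ≠ 0 := fun n =>
      Metric.isOpen_ball.measure_ne_zero _ ⟨y0, Metric.mem_ball_self (hr0 n)⟩
    have hat : ∀ n, a n ≠ ∞ := fun n => measure_ne_top _ _
    -- Mollified indicator of `U`, using balls centred in `U`. It is eventually `1` at each point of
    -- `U`, and by Fubini its `μ`-integral involves only `μ` of balls, which is known; Fatou then
    -- bounds `μ U`.
    set P : ℕ → Sph d → ℝ≥0∞ := fun n x => (a n)⁻¹ * ∫⁻ y in U,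
      (Metric.ball y (r n)).indicator 1 x ∂sphMeasure d with hP
    have hPmeas0 : ∀ n, Measurable fun q : Sph d × Sph d =>
        (Metric.ball q.2 (r n)).indicator (1 : Sph d → ℝ≥0∞) q.1 := by
      intro n
      have : (fun q : Sph d × Sph d => (Metric.ball q.2 (r n)).indicator (1 : Sph d → ℝ≥0∞) q.1)
          = indicator {q : Sph d × Sph d | dist q.1 q.2 < r n} 1 := by
        ext q; simp [indicator]
      rw [this]
      exact measurable_one.indicator (measurableSet_lt measurable_dist measurable_const)
    have hPmeas : ∀ n, Measurable (P n) := fun n =>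
      (Measurable.lintegral_prod_right' (hPmeas0 n)).const_mul _
    have hlim : ∀ x ∈ U, ∀ᶠ n in atTop, P n x = 1 := by
      intro x hx
      obtain ⟨ε, hε, hεU⟩ := Metric.isOpen_iff.1 hU x hx
      have : ∀ᶠ n in atTop, r n < ε :=
        (tendsto_order.1 tendsto_one_div_add_atTop_nhds_zero_nat).2 ε hε
      filter_upwards [this] with n hn
      have e1 : ∫⁻ y in U, (Metric.ball y (r n)).indicator 1 x ∂sphMeasure d = a n := by
        have : (fun y : Sph d => (Metric.ball y (r n)).indicator (1 : Sph d → ℝ≥0∞) x) =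
            (Metric.ball x (r n)).indicator 1 := by
          ext y; simp [indicator, dist_comm]
        rw [this, lintegral_indicator_one Metric.isOpen_ball.measurableSet,
          Measure.restrict_apply Metric.isOpen_ball.measurableSet, inter_eq_left.2, hτ n x]
        exact (Metric.ball_subset_ball hn.le).trans hεU
      simp only [hP, e1]
      exact ENNReal.inv_mul_cancel (ha0 n) (hat n)
    calc μ U = ∫⁻ x, U.indicator 1 x ∂μ := (lintegral_indicator_one hU.measurableSet).symm
      _ ≤ ∫⁻ x, liminf (fun n => P n x) atTop ∂μ := by
          refine lintegral_mono fun x => ?_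
          by_cases hx : x ∈ U
          · have : liminf (fun n => P n x) atTop = 1 := by
              rw [liminf_congr (hlim x hx)]; simp
            simp [this, hx]
          · simp [hx]
      _ ≤ liminf (fun n => ∫⁻ x, P n x ∂μ) atTop := lintegral_liminf_le hPmeas
      _ = liminf (fun _ : ℕ => m * sphMeasure d U) atTop := by
          congr 1
          ext n
          simp only [hP]
          have : SFinite μ := by rw [hμ, hW]; infer_instance
          rw [lintegral_const_mul _ (Measurable.lintegral_prod_right' (hPmeas0 n)),
            lintegral_lintegral_swap (hPmeas0 n).aemeasurable]
          simp_rw [lintegral_indicator_one Metric.isOpen_ball.measurableSet, hball, hτ]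
          rw [lintegral_const, Measure.restrict_apply_univ, mul_comm m, ← mul_assoc, ← mul_assoc,
            ENNReal.inv_mul_cancel (ha0 n) (hat n), one_mul]
      _ = _ := by simp
  refine Measure.le_iff.2 fun s _ => ?_
  rw [Measure.smul_apply, smul_eq_mul]
  refine ENNReal.le_of_forall_pos_le_add fun ε hε _ => ?_
  -- Dividing by `m + 1` rather than `m` covers the case `m = 0`.
  have hε' : (ε : ℝ≥0∞) / (m + 1) ≠ 0 := by
    simp [ENNReal.div_eq_zero_iff, hε.ne', hmt]
  obtain ⟨U, hsU, hUo, hU⟩ := s.exists_isOpen_le_add (sphMeasure d) hε'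
  calc μ s ≤ μ U := measure_mono hsU
    _ ≤ m * sphMeasure d U := hopen U hUo
    _ ≤ m * (sphMeasure d s + ε / (m + 1)) := by gcongr
    _ ≤ m * sphMeasure d s + ε := by
        rw [mul_add]
        gcongr
        calc m * (ε / (m + 1)) ≤ (m + 1) * (ε / (m + 1)) := by gcongr; exact le_self_add
          _ = ε := ENNReal.mul_div_cancel (by simp) (by simp [hmt])

end Sphere

/-! ### Polar coordinates and collisional changes of variables. -/

section ChangeOfVariables

variable {d : ℕ}

lemma lintegral_polar (F : Vel d → ℝ≥0∞) (hd : 0 < d) (hF : Measurable F) :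
    ∫⁻ u, F u = ∫⁻ ω, ∫⁻ ρ in Ioi (0 : ℝ), ENNReal.ofReal (ρ ^ (d - 1)) * F (ρ • (ω : Vel d))
      ∂volume ∂sphMeasure d := by
  have : NeZero d := ⟨hd.ne'⟩
  have hmp := (volume : Measure (Vel d)).measurePreserving_homeomorphUnitSphereProd
  have hfin : Module.finrank ℝ (Vel d) = d := by simp
  rw [hfin] at hmp
  have hmeas : Measurable fun q : Sph d × Ioi (0 : ℝ) => F (q.2.1 • (q.1 : Vel d)) := by fun_prop
  calc ∫⁻ u, F u = ∫⁻ u in ({0}ᶜ : Set (Vel d)), F u := by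
        rw [restrict_compl_singleton]
    _ = ∫⁻ u : ({0}ᶜ : Set (Vel d)), F u ∂(volume.comap Subtype.val) :=
        (lintegral_subtype_comap (measurableSet_singleton _).compl F).symm
    _ = ∫⁻ u : ({0}ᶜ : Set (Vel d)), (fun q : Sph d × Ioi (0 : ℝ) => F (q.2.1 • (q.1 : Vel d)))
          (homeomorphUnitSphereProd (Vel d) u) ∂(volume.comap Subtype.val) := by
        refine lintegral_congr fun u => ?_
        have hu : ‖(u : Vel d)‖ ≠ 0 := norm_ne_zero_iff.2 u.2
        simp [smul_smul, hu]
    _ = ∫⁻ q, F (q.2.1 • (q.1 : Vel d)) ∂((sphMeasure d).prod (Measure.volumeIoiPow (d - 1))) :=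
        hmp.lintegral_comp hmeas
    _ = ∫⁻ ω, ∫⁻ ρ : Ioi (0 : ℝ), F (ρ.1 • (ω : Vel d)) ∂Measure.volumeIoiPow (d - 1)
          ∂sphMeasure d := lintegral_prod _ hmeas.aemeasurable
    _ = _ := by
        refine lintegral_congr fun ω => ?_
        rw [Measure.volumeIoiPow, lintegral_withDensity_eq_lintegral_mul _ (by fun_prop)
          (by fun_prop), ← lintegral_subtype_comap measurableSet_Ioi]
        rfl

lemma lintegral_Ioi_comp_mul_right (g : ℝ → ℝ≥0∞) {c : ℝ} (hc : 0 < c) :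
    ∫⁻ ρ in Ioi (0 : ℝ), g (ρ * c) = ENNReal.ofReal c⁻¹ * ∫⁻ ρ in Ioi (0 : ℝ), g ρ := by
  have h := lintegral_image_eq_lintegral_abs_deriv_mul (s := Ioi (0 : ℝ)) (f := fun x => x * c)
    (f' := fun _ => c) measurableSet_Ioi
    (fun x _ => ((hasDerivAt_id x).mul_const c).hasDerivWithinAt.congr_deriv (by simp))
    (fun x _ y _ h => mul_right_cancel₀ hc.ne' h) g
  have himg : (fun x => x * c) '' Ioi (0 : ℝ) = Ioi 0 := by
    ext y
    simp only [mem_image, mem_Ioi]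
    exact ⟨fun ⟨x, hx, h⟩ => h ▸ mul_pos hx hc, fun hy => ⟨y / c, div_pos hy hc, by field_simp⟩⟩
  rw [himg, lintegral_const_mul' _ _ ENNReal.ofReal_ne_top] at h
  rw [h, ← mul_assoc, ← ENNReal.ofReal_mul (by positivity), abs_of_pos hc,
    inv_mul_cancel₀ hc.ne']
  simp

/-- The unit vector in the direction of `ω + s σ`. -/
def bisector (s : ℝ) (ω σ : Sph d) : Sph d :=
  -- The value in the degenerate case has to commute with rotations, which `ω` does and a fixed
  -- vector would not.
  if h : (ω : Vel d) + s • (σ : Vel d) = 0 then ω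
  else ⟨‖(ω : Vel d) + s • (σ : Vel d)‖⁻¹ • ((ω : Vel d) + s • (σ : Vel d)), by
    rw [mem_sphere_zero_iff_norm, norm_smul, norm_inv, norm_norm,
      inv_mul_cancel₀ (norm_ne_zero_iff.2 h)]⟩

lemma isEquivariant_bisector (s : ℝ) : IsEquivariant (bisector (d := d) s) where
  measurable := by
    have h : MeasurableSet {q : Sph d × Sph d | (q.1 : Vel d) + s • (q.2 : Vel d) = 0} :=
      measurableSet_eq_fun (by fun_prop) (by fun_prop)
    refine (MeasurableEmbedding.subtype_coe
      Metric.isClosed_sphere.measurableSet).measurable_comp_iff.1 ?_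
    have : (Subtype.val ∘ fun q : Sph d × Sph d => bisector s q.1 q.2) = fun q : Sph d × Sph d =>
        if (q.1 : Vel d) + s • (q.2 : Vel d) = 0 then (q.1 : Vel d)
        else ‖(q.1 : Vel d) + s • (q.2 : Vel d)‖⁻¹ • ((q.1 : Vel d) + s • (q.2 : Vel d)) := by
      ext1 q
      simp only [Function.comp, bisector]
      split_ifs <;> rfl
    rw [this]
    exact Measurable.ite h (by fun_prop) (by fun_prop)
  map R x y := by
    have : (R x : Vel d) + s • R y = R ((x : Vel d) + s • (y : Vel d)) := by simp
    unfold bisector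
    ext1
    by_cases h : (x : Vel d) + s • (y : Vel d) = 0
    · simp only [coe_sphMap, this, map_eq_zero_iff R R.injective, h, dite_true]
    · simp only [coe_sphMap, this, map_eq_zero_iff R R.injective, h, dite_false, R.norm_map,
        map_smul]

lemma norm_smul_bisector (s : ℝ) (ω σ : Sph d) :
    ‖(ω : Vel d) + s • (σ : Vel d)‖ • (bisector s ω σ : Vel d) = (ω : Vel d) + s • (σ : Vel d) := by
  unfold bisector
  split_ifs with h
  · simp [h]
  · have : ‖(ω : Vel d) + s • (σ : Vel d)‖ ≠ 0 := norm_ne_zero_iff.2 h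
    simp [smul_smul, this]

lemma inner_sph_mem (ω σ : Sph d) : inner ℝ (ω : Vel d) (σ : Vel d) ∈ Icc (-1 : ℝ) 1 := by
  have := abs_real_inner_le_norm (ω : Vel d) (σ : Vel d)
  simp only [norm_eq_of_mem_sphere, mul_one] at this
  exact abs_le.1 this

/-- The half-angle formulas: the right side is $\cos^2(\theta/2)$ for `s = 1` and $\sin^2(\theta/2)$
for `s = -1`. -/
lemma norm_add_smul_sq {s : ℝ} (hs : s ^ 2 = 1) (ω σ : Sph d) :
    (‖(ω : Vel d) + s • (σ : Vel d)‖ / 2) ^ 2 = (1 + s * inner ℝ (ω : Vel d) (σ : Vel d)) / 2 := by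
  rw [div_pow, norm_add_sq_real, norm_smul, mul_pow, inner_smul_right]
  simp only [norm_eq_of_mem_sphere, Real.norm_eq_abs, sq_abs, hs]
  ring

/-- Change of variables from the relative velocity `u` to `(u ± |u| σ)/2`, for an angular weight
which is supported away from the angle where this change of variables is singular. -/
lemma lintegral_half_sum_le (hd : 0 < d) {s : ℝ} (hs : s ^ 2 = 1) {a : ℝ} (ha : 0 ≤ d + a)
    {c : ℝ} (hc : 0 < c) {w : ℝ → ℝ≥0∞} (hw : Measurable w)
    (hsupp : ∀ t ∈ Icc (-1 : ℝ) 1, w t ≠ 0 → c ^ 2 ≤ (1 + s * t) / 2)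
    {m : ℝ≥0∞} (hm : ∀ e : Sph d, ∫⁻ σ, w (inner ℝ (e : Vel d) (σ : Vel d)) ∂sphMeasure d = m)
    (hmt : m ≠ ∞) (H : Vel d → ℝ≥0∞) (hH : Measurable H) :
    ∫⁻ u : Vel d, ∫⁻ σ, ENNReal.ofReal (‖u‖ ^ a) * w (inner ℝ (‖u‖⁻¹ • u) (σ : Vel d)) *
        H ((1 / 2 : ℝ) • (u + (s * ‖u‖) • (σ : Vel d))) ∂sphMeasure d ≤
      ENNReal.ofReal (c ^ (-(d + a))) * m * ∫⁻ u : Vel d, ENNReal.ofReal (‖u‖ ^ a) * H u := by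
  set K : Sph d → ℝ≥0∞ := fun e => ∫⁻ ρ in Ioi (0 : ℝ), ENNReal.ofReal (ρ ^ (d - 1)) *
    (ENNReal.ofReal (ρ ^ a) * H (ρ • (e : Vel d))) with hK
  have hKm : Measurable K := by
    refine Measurable.lintegral_prod_right' (f := fun q : Sph d × ℝ => ENNReal.ofReal (q.2 ^ (d - 1))
      * (ENNReal.ofReal (q.2 ^ a) * H (q.2 • (q.1 : Vel d)))) ?_
    fun_prop
  have hR : ∫⁻ u : Vel d, ENNReal.ofReal (‖u‖ ^ a) * H u = ∫⁻ e, K e ∂sphMeasure d := by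
    rw [lintegral_polar _ hd (by fun_prop)]
    refine lintegral_congr fun e => setLIntegral_congr_fun measurableSet_Ioi fun ρ hρ => ?_
    simp [norm_smul, abs_of_pos (mem_Ioi.1 hρ)]
  have hmeas : Measurable fun q : Vel d × Sph d => ENNReal.ofReal (‖q.1‖ ^ a) *
      w (inner ℝ (‖q.1‖⁻¹ • q.1) (q.2 : Vel d)) *
        H ((1 / 2 : ℝ) • (q.1 + (s * ‖q.1‖) • (q.2 : Vel d))) := by fun_prop
  rw [hR, lintegral_polar _ hd hmeas.lintegral_prod_right']
  calc _ = ∫⁻ ω, ∫⁻ ρ in Ioi (0 : ℝ), ∫⁻ σ, ENNReal.ofReal (ρ ^ (d - 1)) * (ENNReal.ofReal (ρ ^ a) *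
          w (inner ℝ (ω : Vel d) (σ : Vel d)) *
          H ((ρ / 2) • ((ω : Vel d) + s • (σ : Vel d)))) ∂sphMeasure d ∂volume ∂sphMeasure d := by
        refine lintegral_congr fun ω => setLIntegral_congr_fun measurableSet_Ioi fun ρ hρ => ?_
        have hρ' : ρ ≠ 0 := (mem_Ioi.1 hρ).ne'
        simp only
        rw [← lintegral_const_mul' _ _ ENNReal.ofReal_ne_top]
        refine lintegral_congr fun σ => ?_
        have h1 : ‖ρ • (ω : Vel d)‖ = ρ := by simp [norm_smul, abs_of_pos (mem_Ioi.1 hρ)]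
        rw [h1, smul_smul, inv_mul_cancel₀ hρ', one_smul]
        congr 3
        rw [mul_smul, smul_comm, ← smul_add, smul_smul]
        congr 1; ring
    _ = ∫⁻ ω, ∫⁻ σ, ∫⁻ ρ in Ioi (0 : ℝ), ENNReal.ofReal (ρ ^ (d - 1)) * (ENNReal.ofReal (ρ ^ a) *
          w (inner ℝ (ω : Vel d) (σ : Vel d)) *
          H ((ρ / 2) • ((ω : Vel d) + s • (σ : Vel d)))) ∂volume ∂sphMeasure d ∂sphMeasure d := by
        refine lintegral_congr fun ω => lintegral_lintegral_swap ?_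
        exact Measurable.aemeasurable (by fun_prop)
    _ ≤ ∫⁻ ω, ∫⁻ σ, w (inner ℝ (ω : Vel d) (σ : Vel d)) *
          (ENNReal.ofReal (c ^ (-(d + a))) * K (bisector s ω σ)) ∂sphMeasure d ∂sphMeasure d := by
        refine lintegral_mono fun ω => lintegral_mono fun σ => ?_
        by_cases hw0 : w (inner ℝ (ω : Vel d) (σ : Vel d)) = 0
        · simp [hw0]
        -- For fixed angles the map is $\rho\omega\mapsto(\rho c')\cdot$`bisector`: a dilation of
        -- the radius by `c'`, at least `c` on the support of `w`, together with an equivariant map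
        -- of the directions.
        set c' := ‖(ω : Vel d) + s • (σ : Vel d)‖ / 2 with hc'
        have hcc : c ≤ c' := by
          refine (sq_le_sq₀ hc.le (by positivity)).1 ?_
          rw [hc', norm_add_smul_sq hs]
          exact hsupp _ (inner_sph_mem _ _) hw0
        have hc'0 : 0 < c' := hc.trans_le hcc
        have e1 : ∀ ρ ∈ Ioi (0 : ℝ), ENNReal.ofReal (ρ ^ (d - 1)) * (ENNReal.ofReal (ρ ^ a) *
            w (inner ℝ (ω : Vel d) (σ : Vel d)) *
            H ((ρ / 2) • ((ω : Vel d) + s • (σ : Vel d)))) =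
            w (inner ℝ (ω : Vel d) (σ : Vel d)) * ENNReal.ofReal (c' ^ (-(d - 1 + a))) *
            (fun r => ENNReal.ofReal (r ^ (d - 1)) *
              (ENNReal.ofReal (r ^ a) * H (r • (bisector s ω σ : Vel d)))) (ρ * c') := by
          intro ρ hρ
          have hρ0 : 0 < ρ := hρ
          have e2 : (ρ / 2) • ((ω : Vel d) + s • (σ : Vel d)) =
              (ρ * c') • (bisector s ω σ : Vel d) := by
            rw [← norm_smul_bisector, smul_smul, hc']
            congr 1; ring
          have e3 : ENNReal.ofReal (ρ ^ (d - 1)) * ENNReal.ofReal (ρ ^ a) =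
              ENNReal.ofReal (c' ^ (-(d - 1 + a))) * (ENNReal.ofReal ((ρ * c') ^ (d - 1)) *
              ENNReal.ofReal ((ρ * c') ^ a)) := by
            rw [← ENNReal.ofReal_mul (by positivity), ← ENNReal.ofReal_mul (by positivity),
              ← ENNReal.ofReal_mul (by positivity)]
            congr 1
            have e4 : ∀ x : ℝ, 0 < x → x ^ (d - 1) * x ^ a = x ^ ((d : ℝ) - 1 + a) := by
              intro x hx
              rw [← Real.rpow_natCast, ← Real.rpow_add hx, Nat.cast_sub hd]
              simp
            rw [e4 _ hρ0, e4 _ (by positivity), Real.mul_rpow hρ0.le hc'0.le, mul_comm (ρ ^ _),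
              ← mul_assoc, ← Real.rpow_add hc'0, neg_add_cancel, Real.rpow_zero, one_mul]
          simp only
          rw [e2]
          calc _ = w (inner ℝ (ω : Vel d) (σ : Vel d)) *
                (ENNReal.ofReal (ρ ^ (d - 1)) * ENNReal.ofReal (ρ ^ a)) *
                H ((ρ * c') • (bisector s ω σ : Vel d)) := by ring
            _ = _ := by rw [e3]; ring
        rw [setLIntegral_congr_fun measurableSet_Ioi e1, lintegral_const_mul,
          lintegral_Ioi_comp_mul_right (fun r => ENNReal.ofReal (r ^ (d - 1)) *
              (ENNReal.ofReal (r ^ a) * H (r • (bisector s ω σ : Vel d)))) hc'0]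
        · rw [mul_assoc, ← mul_assoc (ENNReal.ofReal (c' ^ _)),
            ← ENNReal.ofReal_mul (by positivity)]
          gcongr
          -- The weights $\rho^{d-1}\rho^a$ contribute the exponent $-(d-1+a)$ and $d\rho$ one more
          -- $-1$.
          have : c' ^ (-((d : ℝ) - 1 + a)) * c'⁻¹ = c' ^ (-(d + a)) := by
            rw [← Real.rpow_neg_one c', ← Real.rpow_add hc'0]
            congr 1; ring
          rw [this]
          exact Real.rpow_le_rpow_of_nonpos hc hcc (by linarith)
        · fun_prop
    _ = ENNReal.ofReal (c ^ (-(d + a))) * ∫⁻ ω, ∫⁻ σ, w (inner ℝ (ω : Vel d) (σ : Vel d)) *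
          K (bisector s ω σ) ∂sphMeasure d ∂sphMeasure d := by
        rw [← lintegral_const_mul' _ _ ENNReal.ofReal_ne_top]
        refine lintegral_congr fun ω => ?_
        rw [← lintegral_const_mul' _ _ ENNReal.ofReal_ne_top]
        refine lintegral_congr fun σ => ?_
        ring
    _ ≤ _ := by
        rw [mul_assoc]
        gcongr
        exact lintegral_equivariant_le (isEquivariant_bisector s) hw hm hmt K hKm

/-- In polar coordinates the two vectors are $\rho\omega$ and $\rho\sigma$ with the same $\rho$, so
this is the symmetry of $d\omega\,d\sigma$. -/
lemma lintegral_swap_direction (hd : 0 < d) (K : Vel d → Vel d → ℝ≥0∞)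
    (hK : Measurable fun q : Vel d × Vel d => K q.1 q.2) :
    ∫⁻ u : Vel d, ∫⁻ σ, K u (‖u‖ • (σ : Vel d)) ∂sphMeasure d =
      ∫⁻ u : Vel d, ∫⁻ σ, K (‖u‖ • (σ : Vel d)) u ∂sphMeasure d := by
  have h1 : ∀ K : Vel d → Vel d → ℝ≥0∞, (Measurable fun q : Vel d × Vel d => K q.1 q.2) →
      ∫⁻ u : Vel d, ∫⁻ σ, K u (‖u‖ • (σ : Vel d)) ∂sphMeasure d =
      ∫⁻ ω, ∫⁻ σ, ∫⁻ ρ in Ioi (0 : ℝ), ENNReal.ofReal (ρ ^ (d - 1)) *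
        K (ρ • (ω : Vel d)) (ρ • (σ : Vel d)) ∂volume ∂sphMeasure d ∂sphMeasure d := by
    intro K hK
    rw [lintegral_polar _ hd (Measurable.lintegral_prod_right'
      (f := fun q : Vel d × Sph d => K q.1 (‖q.1‖ • (q.2 : Vel d)))
      (hK.comp (by fun_prop : Measurable fun q : Vel d × Sph d =>
        (q.1, ‖q.1‖ • (q.2 : Vel d)))))]
    refine lintegral_congr fun ω => ?_
    rw [← lintegral_lintegral_swap]
    · refine setLIntegral_congr_fun measurableSet_Ioi fun ρ hρ => ?_
      simp only
      rw [← lintegral_const_mul' _ _ ENNReal.ofReal_ne_top]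
      have h1 : ‖ρ • (ω : Vel d)‖ = ρ := by simp [norm_smul, abs_of_pos (mem_Ioi.1 hρ)]
      simp [h1]
    · exact (Measurable.mul (by fun_prop) (hK.comp (by fun_prop : Measurable fun q : ℝ × Sph d =>
        (q.1 • (ω : Vel d), q.1 • (q.2 : Vel d))))).aemeasurable
  rw [h1 K hK, h1 (fun x y => K y x) (hK.comp measurable_swap), lintegral_lintegral_swap]
  refine (Measurable.lintegral_prod_right' (f := fun q : (Sph d × Sph d) × ℝ =>
    ENNReal.ofReal (q.2 ^ (d - 1)) * K (q.2 • (q.1.1 : Vel d)) (q.2 • (q.1.2 : Vel d))) ?_).aemeasurable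
  exact (Measurable.mul (by fun_prop) (hK.comp (by fun_prop :
    Measurable fun q : (Sph d × Sph d) × ℝ =>
        (q.2 • (q.1.1 : Vel d), q.2 • (q.1.2 : Vel d)))))

lemma measurable_vPrime : Measurable fun q : Vel d × Vel d × Sph d => vPrime q.1 q.2.1 q.2.2 := by
  unfold vPrime
  fun_prop

lemma measurable_vStarPrime :
    Measurable fun q : Vel d × Vel d × Sph d => vStarPrime q.1 q.2.1 q.2.2 := by
  unfold vStarPrime
  fun_prop

lemma measurable_cosTheta :
    Measurable fun q : Vel d × Vel d × Sph d => cosTheta q.1 q.2.1 q.2.2 := by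
  unfold cosTheta
  fun_prop

lemma measurable_lintegral_fst {Ψ : Vel d → Vel d → Vel d → ℝ≥0∞}
    (hΨ : Measurable fun q : Vel d × Vel d × Vel d => Ψ q.1 q.2.1 q.2.2) :
    Measurable fun q : Vel d × Vel d => ∫⁻ z : Vel d, Ψ z q.1 q.2 := by
  have h : Measurable fun q : (Vel d × Vel d) × Vel d => Ψ q.2 q.1.1 q.1.2 :=
    hΨ.comp (g := fun q : Vel d × Vel d × Vel d => Ψ q.1 q.2.1 q.2.2)
      (by fun_prop : Measurable fun q : (Vel d × Vel d) × Vel d => (q.2, q.1.1, q.1.2))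
  exact h.lintegral_prod_right'

/-- The passage to centre of mass and relative velocity has unit Jacobian, as two successive
translations show. -/
lemma lintegral_center_of_mass (Ψ : Vel d → Vel d → Vel d → ℝ≥0∞)
    (hΨ : Measurable fun q : Vel d × Vel d × Vel d => Ψ q.1 q.2.1 q.2.2) :
    ∫⁻ v : Vel d, ∫⁻ w : Vel d, ∫⁻ σ,
        Ψ ((1 / 2 : ℝ) • (v + w)) (v - w) (‖v - w‖ • (σ : Vel d)) ∂sphMeasure d =
      ∫⁻ u : Vel d, ∫⁻ σ, (∫⁻ z : Vel d, Ψ z u (‖u‖ • (σ : Vel d))) ∂sphMeasure d := by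
  have hm : Measurable fun q : (Vel d × Vel d) × Sph d =>
      Ψ (q.1.1 - (1 / 2 : ℝ) • q.1.2) q.1.2 (‖q.1.2‖ • (q.2 : Vel d)) :=
    hΨ.comp (by fun_prop : Measurable fun q : (Vel d × Vel d) × Sph d =>
      (q.1.1 - (1 / 2 : ℝ) • q.1.2, q.1.2, ‖q.1.2‖ • (q.2 : Vel d)))
  calc _ = ∫⁻ v : Vel d, ∫⁻ u : Vel d, ∫⁻ σ,
        Ψ (v - (1 / 2 : ℝ) • u) u (‖u‖ • (σ : Vel d)) ∂sphMeasure d := by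
        refine lintegral_congr fun v => ?_
        rw [← lintegral_sub_left_eq_self _ v]
        refine lintegral_congr fun u => lintegral_congr fun σ => ?_
        rw [sub_sub_cancel]
        congr 1
        module
    _ = ∫⁻ u : Vel d, ∫⁻ v : Vel d, ∫⁻ σ,
        Ψ (v - (1 / 2 : ℝ) • u) u (‖u‖ • (σ : Vel d)) ∂sphMeasure d :=
        lintegral_lintegral_swap hm.lintegral_prod_right'.aemeasurable
    _ = _ := by
        refine lintegral_congr fun u => ?_
        rw [lintegral_sub_right_eq_self
          (fun z => ∫⁻ σ, Ψ z u (‖u‖ • (σ : Vel d)) ∂sphMeasure d)]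
        refine lintegral_lintegral_swap ?_
        exact (hΨ.comp (by fun_prop : Measurable fun q : Vel d × Sph d =>
          (q.1, u, ‖u‖ • (q.2 : Vel d)))).aemeasurable

lemma norm_norm_smul (u : Vel d) (σ : Sph d) : ‖‖u‖ • (σ : Vel d)‖ = ‖u‖ := by
  simp [norm_smul]

/-- The pre-post-collisional change of variables. -/
lemma lintegral_pre_post (hd : 0 < d) (k : ℝ → ℝ → ℝ≥0∞)
    (hk : Measurable fun q : ℝ × ℝ => k q.1 q.2) (hk0 : ∀ s, k 0 s = 0)
    (Φ : Vel d → Vel d → Vel d → Vel d → ℝ≥0∞)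
    (hΦ : Measurable fun q : Vel d × Vel d × Vel d × Vel d => Φ q.1 q.2.1 q.2.2.1 q.2.2.2) :
    ∫⁻ v : Vel d, ∫⁻ w : Vel d, ∫⁻ σ, k ‖v - w‖ (cosTheta v w σ) *
        Φ v w (vPrime v w σ) (vStarPrime v w σ) ∂sphMeasure d =
      ∫⁻ v : Vel d, ∫⁻ w : Vel d, ∫⁻ σ, k ‖v - w‖ (cosTheta v w σ) *
        Φ (vPrime v w σ) (vStarPrime v w σ) v w ∂sphMeasure d := by
  -- In these coordinates a collision fixes the centre of mass `z` and exchanges `u` with `u'` of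
  -- equal length. The kernel is written through `u` and `u'` alone, so it is symmetric when the
  -- lengths agree.
  set Ψ : Vel d → Vel d → Vel d → ℝ≥0∞ := fun z u u' =>
    k ‖u‖ (inner ℝ (‖u‖⁻¹ • u) (‖u'‖⁻¹ • u')) *
      Φ (z + (1 / 2 : ℝ) • u) (z - (1 / 2 : ℝ) • u) (z + (1 / 2 : ℝ) • u') (z - (1 / 2 : ℝ) • u')
    with hΨ
  set Ψ' : Vel d → Vel d → Vel d → ℝ≥0∞ := fun z u u' =>
    k ‖u‖ (inner ℝ (‖u‖⁻¹ • u) (‖u'‖⁻¹ • u')) *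
      Φ (z + (1 / 2 : ℝ) • u') (z - (1 / 2 : ℝ) • u') (z + (1 / 2 : ℝ) • u) (z - (1 / 2 : ℝ) • u)
    with hΨ'
  have hmk : Measurable fun q : Vel d × Vel d × Vel d =>
      k ‖q.2.1‖ (inner ℝ (‖q.2.1‖⁻¹ • q.2.1) (‖q.2.2‖⁻¹ • q.2.2)) :=
    hk.comp (by fun_prop : Measurable fun q : Vel d × Vel d × Vel d =>
      (‖q.2.1‖, (inner ℝ (‖q.2.1‖⁻¹ • q.2.1) (‖q.2.2‖⁻¹ • q.2.2) : ℝ)))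
  have hΨm : Measurable fun q : Vel d × Vel d × Vel d => Ψ q.1 q.2.1 q.2.2 :=
    hmk.mul (hΦ.comp (by fun_prop : Measurable fun q : Vel d × Vel d × Vel d =>
      (q.1 + (1 / 2 : ℝ) • q.2.1, q.1 - (1 / 2 : ℝ) • q.2.1, q.1 + (1 / 2 : ℝ) • q.2.2,
        q.1 - (1 / 2 : ℝ) • q.2.2)))
  have hΨm' : Measurable fun q : Vel d × Vel d × Vel d => Ψ' q.1 q.2.1 q.2.2 :=
    hmk.mul (hΦ.comp (by fun_prop : Measurable fun q : Vel d × Vel d × Vel d =>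
      (q.1 + (1 / 2 : ℝ) • q.2.2, q.1 - (1 / 2 : ℝ) • q.2.2, q.1 + (1 / 2 : ℝ) • q.2.1,
        q.1 - (1 / 2 : ℝ) • q.2.1)))
  have hcos : ∀ (v w : Vel d) (σ : Sph d), v - w ≠ 0 →
      cosTheta v w σ = inner ℝ (‖v - w‖⁻¹ • (v - w))
        (‖‖v - w‖ • (σ : Vel d)‖⁻¹ • ‖v - w‖ • (σ : Vel d)) := by
    intro v w σ h
    have h' : ‖v - w‖ ≠ 0 := norm_ne_zero_iff.2 h
    rw [norm_norm_smul, smul_smul, inv_mul_cancel₀ h', one_smul, cosTheta]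
  have e1 : ∀ (v w : Vel d) (σ : Sph d), k ‖v - w‖ (cosTheta v w σ) *
      Φ v w (vPrime v w σ) (vStarPrime v w σ) =
      Ψ ((1 / 2 : ℝ) • (v + w)) (v - w) (‖v - w‖ • (σ : Vel d)) := by
    intro v w σ
    -- For `v = w` the direction is undefined, but the kernel vanishes there by `hk0`.
    by_cases h : v - w = 0
    · simp [hΨ, h, hk0]
    · simp only [hΨ]
      rw [← hcos v w σ h]
      congr 2
      · module
      · module
      · unfold vPrime; module
      · unfold vStarPrime; module
  have e2 : ∀ (v w : Vel d) (σ : Sph d), k ‖v - w‖ (cosTheta v w σ) *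
      Φ (vPrime v w σ) (vStarPrime v w σ) v w =
      Ψ' ((1 / 2 : ℝ) • (v + w)) (v - w) (‖v - w‖ • (σ : Vel d)) := by
    intro v w σ
    by_cases h : v - w = 0
    · simp [hΨ', h, hk0]
    · simp only [hΨ']
      rw [← hcos v w σ h]
      congr 2
      · unfold vPrime; module
      · unfold vStarPrime; module
      · module
      · module
  simp_rw [e1, e2]
  rw [lintegral_center_of_mass _ hΨm, lintegral_center_of_mass _ hΨm',
    lintegral_swap_direction hd (fun u u' => ∫⁻ z : Vel d, Ψ z u u')]
  · refine lintegral_congr fun u => lintegral_congr fun σ => lintegral_congr fun z => ?_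
    simp only [hΨ, hΨ', norm_norm_smul]
    rw [real_inner_comm]
  · exact measurable_lintegral_fst hΨm

end ChangeOfVariables

/-! ### Bounds on the Maxwellian and the collision frequency. -/

section CollisionFrequency

variable {d : ℕ} {γ : ℝ}

/-- The Maxwellian with values in `[0,∞]`. -/
def mx (v : Vel d) : ℝ≥0∞ := ENNReal.ofReal (maxwellian d v)

/-- The collision frequency `ν(v) = ∫ |v - v_*|^γ ℳ(v_*) dv_*`. -/
def collFreq (γ : ℝ) (v : Vel d) : ℝ≥0∞ := ∫⁻ w, ENNReal.ofReal (‖v - w‖ ^ γ) * mx w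

lemma maxwellian_pos (v : Vel d) : 0 < maxwellian d v := by
  unfold maxwellian
  positivity

@[fun_prop]
lemma continuous_maxwellian : Continuous (maxwellian d) := by
  unfold maxwellian
  fun_prop

@[fun_prop]
lemma measurable_mx : Measurable (mx : Vel d → ℝ≥0∞) :=
  continuous_maxwellian.measurable.ennreal_ofReal

@[fun_prop]
lemma measurable_collFreq : Measurable (collFreq γ : Vel d → ℝ≥0∞) := by
  unfold collFreq
  refine Measurable.lintegral_prod_right' (f := fun q : Vel d × Vel d =>
    ENNReal.ofReal (‖q.1 - q.2‖ ^ γ) * mx q.2) ?_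
  fun_prop

lemma collFreq_eq (v : Vel d) :
    collFreq γ v = ∫⁻ u, ENNReal.ofReal (‖u‖ ^ γ) * mx (v - u) := by
  rw [collFreq, ← lintegral_sub_left_eq_self _ v]
  simp

lemma integrable_maxwellian : Integrable (maxwellian d) := by
  have h : Integrable fun v : Vel d => Real.exp (-(1 / 2 : ℝ) * ‖v‖ ^ 2) := by
    have := (GaussianFourier.integrable_cexp_neg_mul_sq_norm_add (V := Vel d)
      (b := (1 / 2 : ℂ)) (by norm_num) 0 0).norm
    refine this.congr (.of_forall fun v => ?_)
    simp only [Complex.norm_exp]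
    congr 1
    have : (-(1 / 2 : ℂ) * (‖v‖ : ℂ) ^ 2 + 0 * (inner ℝ (0 : Vel d) v : ℝ)) =
      ((-(1 / 2 : ℝ) * ‖v‖ ^ 2 : ℝ) : ℂ) := by push_cast; ring
    rw [this, Complex.ofReal_re]
  refine (h.const_mul (1 / (2 * Real.pi) ^ ((d : ℝ) / 2))).congr (.of_forall fun v => ?_)
  simp only [maxwellian]
  congr 2
  ring

lemma lintegral_mx_ne_top : ∫⁻ v : Vel d, mx v ≠ ∞ := by
  have := (integrable_maxwellian (d := d)).lintegral_lt_top
  exact this.ne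

lemma maxwellian_le_const (v : Vel d) :
    maxwellian d v ≤ 1 / (2 * Real.pi) ^ ((d : ℝ) / 2) := by
  unfold maxwellian
  have : Real.exp (-‖v‖ ^ 2 / 2) ≤ 1 := by
    rw [Real.exp_le_one_iff]
    have := sq_nonneg ‖v‖
    linarith
  exact mul_le_of_le_one_right (by positivity) this

lemma maxwellian_le_bracket (v : Vel d) : maxwellian d v ≤
    1 / (2 * Real.pi) ^ ((d : ℝ) / 2) * Real.exp (γ ^ 2 / 2) * (1 + ‖v‖) ^ γ := by
  unfold maxwellian
  rw [mul_assoc]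
  refine mul_le_mul_of_nonneg_left ?_ (by positivity)
  have h0 : 0 < 1 + ‖v‖ := by positivity
  rw [Real.rpow_def_of_pos h0, ← Real.exp_add, Real.exp_le_exp]
  rcases le_total 0 γ with h | h
  · have : 0 ≤ Real.log (1 + ‖v‖) := Real.log_nonneg (by linarith [norm_nonneg v])
    nlinarith [sq_nonneg ‖v‖, sq_nonneg γ]
  · have : Real.log (1 + ‖v‖) ≤ ‖v‖ := by
      have := Real.log_le_sub_one_of_pos h0
      linarith
    -- Completing the square: $-|v|^2/2\le\gamma^2/2+\gamma|v|\le\gamma^2/2+\gamma\log(1+|v|)$ for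
    -- $\gamma\le0$.
    nlinarith [sq_nonneg (‖v‖ + γ)]

/-- A Peetre-type inequality: $1+|v|\le(1+t)(1+|w|)$, raised to a negative power. -/
lemma bracket_mul_le (hγ : γ < 0) (v w : Vel d) {t : ℝ} (ht : ‖v - w‖ ≤ t) :
    (1 + t) ^ γ * (1 + ‖w‖) ^ γ ≤ (1 + ‖v‖) ^ γ := by
  have ht0 : 0 ≤ t := (norm_nonneg _).trans ht
  rw [← Real.mul_rpow (by positivity) (by positivity)]
  refine Real.rpow_le_rpow_of_nonpos (by positivity) ?_ hγ.le
  have := norm_le_norm_add_norm_sub' v w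
  nlinarith [norm_nonneg w, mul_nonneg ht0 (norm_nonneg w)]

lemma lintegral_ball_rpow_ne_top (hd : 0 < d) (hγd : -(d : ℝ) < γ) :
    ∫⁻ u in Metric.ball (0 : Vel d) 1, ENNReal.ofReal (‖u‖ ^ γ) ≠ ∞ := by
  have : NeZero d := ⟨hd.ne'⟩
  have h : IntegrableOn (fun u : Vel d => ‖u‖ ^ γ) (Metric.ball 0 1) := by
    rw [integrableOn_fun_norm_addHaar volume (f := fun r => r ^ γ)]
    have h1 : IntegrableOn (fun y : ℝ => y ^ ((d : ℝ) - 1 + γ)) (Ioo 0 1) := by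
      rw [intervalIntegral.integrableOn_Ioo_rpow_iff (by norm_num)]
      linarith
    refine h1.congr_fun (fun y hy => ?_) measurableSet_Ioo
    simp only [finrank_euclideanSpace, Fintype.card_fin, smul_eq_mul]
    rw [← Real.rpow_natCast, ← Real.rpow_add hy.1, Nat.cast_sub hd]
    simp
  exact h.lintegral_lt_top.ne

/-- Near the singularity $|u|^\gamma$ is integrable and $\mathcal M$ bounded; elsewhere
$|u|^\gamma\le1$ and $\mathcal M$ is integrable. -/
lemma exists_collFreq_le (hd : 0 < d) (hγd : -(d : ℝ) < γ) (hγ : γ < 0) :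
    ∃ K : ℝ≥0, ∀ v : Vel d, collFreq γ v ≤ K := by
  set S := ∫⁻ u in Metric.ball (0 : Vel d) 1, ENNReal.ofReal (‖u‖ ^ γ)
  set c := ENNReal.ofReal (1 / (2 * Real.pi) ^ ((d : ℝ) / 2))
  have hK : S * c + ∫⁻ v : Vel d, mx v ≠ ∞ := ENNReal.add_ne_top.2
    ⟨ENNReal.mul_ne_top (lintegral_ball_rpow_ne_top hd hγd) ENNReal.ofReal_ne_top,
      lintegral_mx_ne_top⟩
  refine ⟨(S * c + ∫⁻ v : Vel d, mx v).toNNReal, fun v => ?_⟩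
  rw [ENNReal.coe_toNNReal hK, collFreq_eq,
    ← lintegral_add_compl _ (Metric.isOpen_ball (x := (0 : Vel d)) (ε := 1)).measurableSet]
  refine add_le_add ?_ ?_
  · rw [← lintegral_mul_const _ (by fun_prop)]
    refine lintegral_mono fun u => ?_
    gcongr
    exact ENNReal.ofReal_le_ofReal (maxwellian_le_const _)
  · calc _ ≤ ∫⁻ u in (Metric.ball (0 : Vel d) 1)ᶜ, mx (v - u) := by
          refine setLIntegral_mono (by fun_prop) fun u hu => ?_
          have hu1 : 1 ≤ ‖u‖ := by simpa using hu
          refine mul_le_of_le_one_left zero_le ?_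
          rw [ENNReal.ofReal_le_one]
          exact Real.rpow_le_one_of_one_le_of_nonpos hu1 hγ.le
      _ ≤ ∫⁻ u, mx (v - u) := setLIntegral_le_lintegral _ _
      _ = _ := lintegral_sub_left_eq_self _ v

/-- Velocities `w` in the unit ball suffice: there $|v-w|\le1+|v|$ and the Maxwellian is bounded
below. -/
lemma exists_bracket_le_collFreq (hd : 0 < d) (hγ : γ < 0) :
    ∃ K : ℝ≥0, ∀ v : Vel d, ENNReal.ofReal ((1 + ‖v‖) ^ γ) ≤ K * collFreq γ v := by
  have : NeZero d := ⟨hd.ne'⟩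
  set m0 : ℝ := 1 / (2 * Real.pi) ^ ((d : ℝ) / 2) * Real.exp (-1 / 2) with hm0
  have hm0p : 0 < m0 := by positivity
  set V := volume (Metric.ball (0 : Vel d) 1) with hV
  have hV0 : V ≠ 0 := Metric.isOpen_ball.measure_ne_zero _ ⟨0, by simp⟩
  have hVt : V ≠ ∞ := measure_ball_lt_top.ne
  set c := ENNReal.ofReal m0 * V with hc
  have hc0 : c ≠ 0 := mul_ne_zero (by simpa using hm0p) hV0
  have hct : c ≠ ∞ := ENNReal.mul_ne_top ENNReal.ofReal_ne_top hVt
  refine ⟨(c⁻¹).toNNReal, fun v => ?_⟩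
  rw [ENNReal.coe_toNNReal (ENNReal.inv_ne_top.2 hc0)]
  have key : c * ENNReal.ofReal ((1 + ‖v‖) ^ γ) ≤ collFreq γ v := by
    calc c * ENNReal.ofReal ((1 + ‖v‖) ^ γ)
        = ∫⁻ w in Metric.ball (0 : Vel d) 1, ENNReal.ofReal ((1 + ‖v‖) ^ γ) * ENNReal.ofReal m0 := by
          rw [lintegral_const, Measure.restrict_apply_univ, hc]
          ring
      _ ≤ ∫⁻ w in Metric.ball (0 : Vel d) 1, ENNReal.ofReal (‖v - w‖ ^ γ) * mx w := by
          refine lintegral_mono_ae ?_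
          have hne : ∀ᵐ w : Vel d, w ≠ v := by simp [ae_iff]
          filter_upwards [ae_restrict_mem Metric.isOpen_ball.measurableSet,
            ae_restrict_of_ae hne] with w hw hwv
          have hw1 : ‖w‖ < 1 := by simpa using hw
          gcongr ?_ * ?_
          · refine ENNReal.ofReal_le_ofReal (Real.rpow_le_rpow_of_nonpos
              (norm_pos_iff.2 (sub_ne_zero.2 hwv.symm)) ?_ hγ.le)
            linarith [norm_sub_le v w]
          · refine ENNReal.ofReal_le_ofReal ?_
            unfold maxwellian
            rw [hm0]
            gcongr
            nlinarith [norm_nonneg w]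
      _ ≤ _ := setLIntegral_le_lintegral _ _
  calc ENNReal.ofReal ((1 + ‖v‖) ^ γ) = c⁻¹ * (c * ENNReal.ofReal ((1 + ‖v‖) ^ γ)) := by
        rw [← mul_assoc, ENNReal.inv_mul_cancel hc0 hct, one_mul]
    _ ≤ _ := by gcongr

/-- The Maxwellian decays faster than $(1+|v|)^\gamma$, hence faster than $\nu$; a shift of length
at most `1` costs only the factor $2^{-\gamma}$. -/
lemma exists_mx_shift_le (hd : 0 < d) (hγ : γ < 0) :
    ∃ K : ℝ≥0, ∀ v h : Vel d, ‖h‖ ≤ 1 → mx (v - h) ≤ K * collFreq γ v := by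
  obtain ⟨K, hK⟩ := exists_bracket_le_collFreq (γ := γ) hd hγ
  set c : ℝ := 1 / (2 * Real.pi) ^ ((d : ℝ) / 2) * Real.exp (γ ^ 2 / 2) with hc
  have hc0 : 0 ≤ c := by positivity
  refine ⟨(c * 2 ^ (-γ)).toNNReal * K, fun v h hh => ?_⟩
  rw [ENNReal.coe_mul, mul_assoc]
  refine le_trans ?_ (mul_le_mul_right (hK v) _)
  change ENNReal.ofReal _ ≤ ENNReal.ofReal _ * _
  rw [← ENNReal.ofReal_mul (by positivity)]
  refine ENNReal.ofReal_le_ofReal ((maxwellian_le_bracket (γ := γ) _).trans ?_)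
  change c * _ ≤ _
  rw [mul_assoc c]
  refine mul_le_mul_of_nonneg_left ?_ hc0
  have := bracket_mul_le hγ v (v - h) (t := 1) (by simpa using hh)
  have h2 : (2 : ℝ) ^ (-γ) * (1 + 1) ^ γ = 1 := by
    rw [one_add_one_eq_two, ← Real.rpow_add (by norm_num)]; simp
  calc (1 + ‖v - h‖) ^ γ = 2 ^ (-γ) * ((1 + 1) ^ γ * (1 + ‖v - h‖) ^ γ) := by
        rw [← mul_assoc, h2, one_mul]
    _ ≤ _ := by gcongr

/-- The speed `t` is kept apart from `‖v - w‖` because the bound is applied to $v'$ and $v_*$, with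
`t` the full relative speed $|v-v_*|\ge|v'-v_*|$. -/
lemma exists_far_le (hd : 0 < d) (hγ : γ < 0) {r : ℝ} (hr : 0 < r) :
    ∃ K : ℝ≥0, ∀ (t : ℝ) (v w : Vel d), r ≤ t → ‖v - w‖ ≤ t →
      ENNReal.ofReal (t ^ γ) * mx w ≤ K * collFreq γ v := by
  obtain ⟨K, hK⟩ := exists_bracket_le_collFreq (γ := γ) hd hγ
  set c : ℝ := 1 / (2 * Real.pi) ^ ((d : ℝ) / 2) * Real.exp (γ ^ 2 / 2) with hc
  have hc0 : 0 ≤ c := by positivity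
  refine ⟨(c * (1 + 1 / r) ^ (-γ)).toNNReal * K, fun t v w hrt hvw => ?_⟩
  have ht : 0 < t := hr.trans_le hrt
  rw [ENNReal.coe_mul, mul_assoc]
  refine le_trans ?_ (mul_le_mul_right (hK v) _)
  change _ * ENNReal.ofReal _ ≤ ENNReal.ofReal _ * _
  rw [← ENNReal.ofReal_mul (by positivity), ← ENNReal.ofReal_mul (by positivity)]
  refine ENNReal.ofReal_le_ofReal ?_
  -- For $t\ge r$ one has $1+t\le(1+1/r)\,t$, which removes the singularity at zero relative speed.
  have h1 : t ^ γ ≤ (1 + 1 / r) ^ (-γ) * (1 + t) ^ γ := by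
    have : (1 + 1 / r) ^ (-γ) = ((1 + 1 / r)⁻¹) ^ γ := by
      rw [Real.inv_rpow (by positivity), Real.rpow_neg (by positivity)]
    rw [this, ← Real.mul_rpow (by positivity) (by positivity)]
    refine Real.rpow_le_rpow_of_nonpos (by positivity) ?_ hγ.le
    rw [inv_mul_le_iff₀ (by positivity)]
    have : 1 ≤ 1 / r * t := by
      rw [one_div, inv_mul_eq_div, le_div_iff₀ hr]; linarith
    linarith
  calc t ^ γ * maxwellian d w
      ≤ ((1 + 1 / r) ^ (-γ) * (1 + t) ^ γ) * (c * (1 + ‖w‖) ^ γ) := by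
        gcongr
        · exact (maxwellian_pos _).le
        · exact maxwellian_le_bracket _
    _ = c * (1 + 1 / r) ^ (-γ) * ((1 + t) ^ γ * (1 + ‖w‖) ^ γ) := by ring
    _ ≤ _ := by
        gcongr
        exact bracket_mul_le hγ v w hvw

/-- Absolute continuity of the integral of $|u|^\gamma$, which is locally integrable as $\gamma>-d$.
-/
lemma exists_radius_small (hd : 0 < d) (hγd : -(d : ℝ) < γ) (K : ℝ≥0) {ε : ℝ≥0∞} (hε : 0 < ε) :
    ∃ r : ℝ, 0 < r ∧ r ≤ 1 ∧
      K * ∫⁻ u in Metric.ball (0 : Vel d) r, ENNReal.ofReal (‖u‖ ^ γ) ≤ ε := by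
  have : NeZero d := ⟨hd.ne'⟩
  have h1 : Tendsto (fun r : ℝ => volume.restrict (Metric.ball (0 : Vel d) 1)
      (Metric.ball (0 : Vel d) r)) (𝓝[>] 0) (𝓝 0) := by
    have h2 : Tendsto (fun r : ℝ => volume (Metric.ball (0 : Vel d) r)) (𝓝[>] 0) (𝓝 0) := by
      have h3 : Tendsto (fun r : ℝ => ENNReal.ofReal (r ^ d) *
          volume (Metric.ball (0 : Vel d) 1)) (𝓝[>] 0) (𝓝 0) := by
        have h4 : Tendsto (fun r : ℝ => ENNReal.ofReal (r ^ d)) (𝓝[>] 0) (𝓝 0) := by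
          have : Continuous fun r : ℝ => ENNReal.ofReal (r ^ d) :=
            ENNReal.continuous_ofReal.comp (by fun_prop)
          simpa [hd.ne'] using (this.tendsto 0).mono_left nhdsWithin_le_nhds
        simpa using ENNReal.Tendsto.mul_const h4 (Or.inr measure_ball_lt_top.ne)
      refine h3.congr' ?_
      filter_upwards [self_mem_nhdsWithin] with r hr
      rw [Measure.addHaar_ball_of_pos volume (0 : Vel d) hr]
      simp
    exact tendsto_of_tendsto_of_tendsto_of_le_of_le tendsto_const_nhds h2 (fun _ => zero_le)
      (fun r => Measure.restrict_apply_le _ _)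
  have h3 := tendsto_setLIntegral_zero (lintegral_ball_rpow_ne_top hd hγd) h1
  have h4 : Tendsto (fun r : ℝ => K * ∫⁻ u in Metric.ball (0 : Vel d) r,
      ENNReal.ofReal (‖u‖ ^ γ) ∂(volume.restrict (Metric.ball (0 : Vel d) 1))) (𝓝[>] 0) (𝓝 0) := by
    simpa using ENNReal.Tendsto.const_mul h3 (Or.inr (ENNReal.coe_ne_top (r := K)))
  have h5 : ∀ᶠ r in 𝓝[>] (0 : ℝ), r ≤ 1 :=
    (eventually_le_nhds (by norm_num : (0 : ℝ) < 1)).filter_mono nhdsWithin_le_nhds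
  obtain ⟨r, ⟨hr1, hr2⟩, hr3⟩ := (((h4.eventually_lt_const hε).and h5).and
    self_mem_nhdsWithin).exists
  refine ⟨r, hr3, hr2, le_of_eq_of_le ?_ hr1.le⟩
  rw [Measure.restrict_restrict Metric.isOpen_ball.measurableSet,
    inter_eq_left.2 (Metric.ball_subset_ball hr2)]

end CollisionFrequency

/-! ### The gain form and its bounds in the three collision regimes. -/

section GainForm

variable {d : ℕ} {γ : ℝ}

/-- The bilinear form `∫ φ(v) (L⁺ f)(v) dv` of the gain part of the linear Boltzmann operator with
angular weight `w`, restricted by a cut-off `χ` in the relative speed. -/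
def gainForm (γ : ℝ) (χ : ℝ → ℝ≥0∞) (w : ℝ → ℝ≥0∞) (Φ : Vel d → Vel d → ℝ≥0∞) : ℝ≥0∞ :=
  ∫⁻ v : Vel d, ∫⁻ v₁ : Vel d, ∫⁻ σ, (ENNReal.ofReal (‖v - v₁‖ ^ γ) * χ ‖v - v₁‖ *
    w (cosTheta v v₁ σ)) * (Φ v (vPrime v v₁ σ) * mx (vStarPrime v v₁ σ)) ∂sphMeasure d

variable {χ : ℝ → ℝ≥0∞} {w : ℝ → ℝ≥0∞} {m : ℝ≥0∞}

lemma measurable_gain_integrand (hχ : Measurable χ) (hw : Measurable w)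
    {Φ : Vel d → Vel d → ℝ≥0∞} (hΦ : Measurable fun q : Vel d × Vel d => Φ q.1 q.2) :
    Measurable fun q : Vel d × Vel d × Sph d =>
      (ENNReal.ofReal (‖q.1 - q.2.1‖ ^ γ) * χ ‖q.1 - q.2.1‖ *
      w (cosTheta q.1 q.2.1 q.2.2)) *
      (Φ q.1 (vPrime q.1 q.2.1 q.2.2) * mx (vStarPrime q.1 q.2.1 q.2.2)) := by
  have h1 := measurable_vPrime (d := d)
  have h2 := measurable_vStarPrime (d := d)
  have h3 := measurable_cosTheta (d := d)
  have h4 : Measurable fun q : Vel d × Vel d × Sph d => Φ q.1 (vPrime q.1 q.2.1 q.2.2) :=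
    hΦ.comp (measurable_fst.prodMk h1)
  fun_prop

lemma gainForm_mono {χ χ' : ℝ → ℝ≥0∞} {w w' : ℝ → ℝ≥0∞} {Φ Φ' : Vel d → Vel d → ℝ≥0∞}
    (h1 : ∀ t, χ t ≤ χ' t) (h2 : ∀ t, w t ≤ w' t) (h3 : ∀ x y, Φ x y ≤ Φ' x y) :
    gainForm γ χ w Φ ≤ gainForm γ χ' w' Φ' := by
  unfold gainForm
  gcongr
  · exact h1 _
  · exact h2 _
  · exact h3 _ _

lemma lintegral_triple_add {f g : Vel d → Vel d → Sph d → ℝ≥0∞}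
    (hf : Measurable fun q : Vel d × Vel d × Sph d => f q.1 q.2.1 q.2.2) :
    ∫⁻ v, ∫⁻ v₁, ∫⁻ σ, (f v v₁ σ + g v v₁ σ) ∂sphMeasure d =
      (∫⁻ v, ∫⁻ v₁, ∫⁻ σ, f v v₁ σ ∂sphMeasure d) +
        ∫⁻ v, ∫⁻ v₁, ∫⁻ σ, g v v₁ σ ∂sphMeasure d := by
  have h1 : ∀ v v₁, Measurable fun σ => f v v₁ σ := fun v v₁ =>
    hf.comp (by fun_prop : Measurable fun σ : Sph d => (v, v₁, σ))
  have h2 : ∀ v, Measurable fun v₁ => ∫⁻ σ, f v v₁ σ ∂sphMeasure d := fun v =>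
    Measurable.lintegral_prod_right' (f := fun q : Vel d × Sph d => f v q.1 q.2)
      (hf.comp (by fun_prop : Measurable fun q : Vel d × Sph d => (v, q.1, q.2)))
  have h3 : Measurable fun v => ∫⁻ v₁, ∫⁻ σ, f v v₁ σ ∂sphMeasure d := by
    refine Measurable.lintegral_prod_right' (f := fun q : Vel d × Vel d =>
      ∫⁻ σ, f q.1 q.2 σ ∂sphMeasure d) ?_
    exact Measurable.lintegral_prod_right' (f := fun q : (Vel d × Vel d) × Sph d =>
      f q.1.1 q.1.2 q.2) (hf.comp (by fun_prop : Measurable fun q : (Vel d × Vel d) × Sph d =>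
        (q.1.1, q.1.2, q.2)))
  rw [← lintegral_add_left h3]
  refine lintegral_congr fun v => ?_
  rw [← lintegral_add_left (h2 v)]
  exact lintegral_congr fun v₁ => lintegral_add_left (h1 v v₁) _

lemma lintegral_sph_const_mul (a : ℝ≥0∞) {F : Vel d → Sph d → ℝ≥0∞}
    (hF : Measurable fun q : Vel d × Sph d => F q.1 q.2) :
    ∫⁻ u, ∫⁻ σ, a * F u σ ∂sphMeasure d = a * ∫⁻ u, ∫⁻ σ, F u σ ∂sphMeasure d := by
  rw [← lintegral_const_mul _ hF.lintegral_prod_right']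
  exact lintegral_congr fun u => lintegral_const_mul _ (hF.comp measurable_prodMk_left)

lemma gainForm_add (hχ : Measurable χ) (hw : Measurable w) {Φ Ψ : Vel d → Vel d → ℝ≥0∞}
    (hΦ : Measurable fun q : Vel d × Vel d => Φ q.1 q.2) :
    gainForm γ χ w (fun x y => Φ x y + Ψ x y) = gainForm γ χ w Φ + gainForm γ χ w Ψ := by
  unfold gainForm
  rw [← lintegral_triple_add (measurable_gain_integrand hχ hw hΦ)]
  simp_rw [add_mul, mul_add]

lemma gainForm_add_weight {χ' w' : ℝ → ℝ≥0∞} (hχ : Measurable χ) (hw : Measurable w)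
    {Φ : Vel d → Vel d → ℝ≥0∞}
    (hΦ : Measurable fun q : Vel d × Vel d => Φ q.1 q.2) {W : ℝ → ℝ≥0∞}
    (h : ∀ t s, W s ≤ χ t * w s + χ' t * w' s) :
    gainForm γ 1 W Φ ≤ gainForm γ χ w Φ + gainForm γ χ' w' Φ := by
  unfold gainForm
  rw [← lintegral_triple_add (measurable_gain_integrand hχ hw hΦ)]
  refine lintegral_mono fun v => lintegral_mono fun v₁ => lintegral_mono fun σ => ?_
  rw [← add_mul]
  gcongr
  rw [mul_assoc, mul_assoc, mul_assoc, ← mul_add, Pi.one_apply, one_mul]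
  gcongr
  exact h _ _

lemma gainForm_swap (hd : 0 < d) (hγ : γ < 0) (hχ : Measurable χ) (hw : Measurable w)
    {Φ : Vel d → Vel d → ℝ≥0∞} (hΦ : Measurable fun q : Vel d × Vel d => Φ q.1 q.2) :
    gainForm γ χ w Φ = ∫⁻ v : Vel d, ∫⁻ v₁ : Vel d, ∫⁻ σ, (ENNReal.ofReal (‖v - v₁‖ ^ γ) *
      χ ‖v - v₁‖ * w (cosTheta v v₁ σ)) * (Φ (vPrime v v₁ σ) v * mx v₁) ∂sphMeasure d := by
  refine lintegral_pre_post hd (fun t s => ENNReal.ofReal (t ^ γ) * χ t * w s) (by fun_prop)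
    (fun s => by simp [Real.zero_rpow hγ.ne]) (fun v _ v' v₁' => Φ v v' * mx v₁') ?_
  have : Measurable fun q : Vel d × Vel d × Vel d × Vel d => Φ q.1 q.2.2.1 :=
    hΦ.comp (by fun_prop : Measurable fun q : Vel d × Vel d × Vel d × Vel d => (q.1, q.2.2.1))
  fun_prop

/-- The factor $|v-v_1|^\gamma$ is kept on both sides: at `v = v₁` there is no unit direction, but
the real power `0 ^ γ` is then `0`. -/
lemma lintegral_angular (hγ : γ < 0)
    (hm : ∀ e : Sph d, ∫⁻ σ, w (inner ℝ (e : Vel d) (σ : Vel d)) ∂sphMeasure d = m)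
    (v v₁ : Vel d) :
    ENNReal.ofReal (‖v - v₁‖ ^ γ) * ∫⁻ σ, w (cosTheta v v₁ σ) ∂sphMeasure d =
      ENNReal.ofReal (‖v - v₁‖ ^ γ) * m := by
  by_cases h : v - v₁ = 0
  · simp [h, Real.zero_rpow hγ.ne]
  · congr 1
    exact hm ⟨‖v - v₁‖⁻¹ • (v - v₁), by
      rw [mem_sphere_zero_iff_norm, norm_smul, norm_inv, norm_norm,
        inv_mul_cancel₀ (norm_ne_zero_iff.2 h)]⟩

/-- The gain form of a function of the pre-collisional velocity only. -/
lemma gainForm_pre (hd : 0 < d) (hγ : γ < 0) (hχ : Measurable χ) (hw : Measurable w)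
    (hm : ∀ e : Sph d, ∫⁻ σ, w (inner ℝ (e : Vel d) (σ : Vel d)) ∂sphMeasure d = m)
    {β : Vel d → ℝ≥0∞} (hβ : Measurable β) :
    gainForm γ χ w (fun _ y => β y) = m * ∫⁻ v : Vel d, β v *
      ∫⁻ u : Vel d, ENNReal.ofReal (‖u‖ ^ γ) * χ ‖u‖ * mx (v - u) := by
  have hm1 : Measurable fun q : Vel d × Vel d =>
      ENNReal.ofReal (‖q.2‖ ^ γ) * χ ‖q.2‖ * mx (q.1 - q.2) := by fun_prop
  have hm2 : Measurable fun v : Vel d => β v *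
      ∫⁻ u : Vel d, ENNReal.ofReal (‖u‖ ^ γ) * χ ‖u‖ * mx (v - u) :=
    hβ.mul hm1.lintegral_prod_right'
  rw [gainForm_swap hd hγ hχ hw (hβ.comp measurable_snd), ← lintegral_const_mul _ hm2]
  refine lintegral_congr fun v => ?_
  have hm3 : Measurable fun u : Vel d => ENNReal.ofReal (‖u‖ ^ γ) * χ ‖u‖ * mx (v - u) := by fun_prop
  refine Eq.trans ?_ ((lintegral_const_mul (m * β v) hm3).trans (mul_assoc _ _ _))
  refine (lintegral_sub_left_eq_self _ v).symm.trans (lintegral_congr fun u => ?_)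
  have hc : Measurable fun σ : Sph d => w (cosTheta v (v - u) σ) := by
    unfold cosTheta
    fun_prop
  have := lintegral_angular hγ hm v (v - u)
  calc _ = ∫⁻ σ, (ENNReal.ofReal (‖v - (v - u)‖ ^ γ) * w (cosTheta v (v - u) σ)) *
          (χ ‖v - (v - u)‖ * (β v * mx (v - u))) ∂sphMeasure d :=
        lintegral_congr fun σ => by ring
    _ = (ENNReal.ofReal (‖v - (v - u)‖ ^ γ) * ∫⁻ σ, w (cosTheta v (v - u) σ) ∂sphMeasure d) *
          (χ ‖v - (v - u)‖ * (β v * mx (v - u))) := by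
        rw [lintegral_mul_const _ (hc.const_mul _), lintegral_const_mul _ hc]
    _ = _ := by
        rw [this, sub_sub_cancel]
        ring

/-- The gain form of a function of the post-collisional velocity only, in terms of the relative
velocity. -/
lemma gainForm_post (hχ : Measurable χ) (hw : Measurable w) {G : Vel d → ℝ≥0∞} :
    gainForm γ χ w (fun x _ => G x) = ∫⁻ v : Vel d, G v *
      ∫⁻ u : Vel d, ∫⁻ σ, ENNReal.ofReal (‖u‖ ^ γ) * χ ‖u‖ *
        w (inner ℝ (‖u‖⁻¹ • u) (σ : Vel d)) *
          mx (v - (1 / 2 : ℝ) • (u + ((1 : ℝ) * ‖u‖) • (σ : Vel d))) ∂sphMeasure d := by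
  refine lintegral_congr fun v => ?_
  have hm1 : Measurable fun q : Vel d × Sph d => ENNReal.ofReal (‖q.1‖ ^ γ) * χ ‖q.1‖ *
        w (inner ℝ (‖q.1‖⁻¹ • q.1) (q.2 : Vel d)) *
          mx (v - (1 / 2 : ℝ) • (q.1 + ((1 : ℝ) * ‖q.1‖) • (q.2 : Vel d))) := by fun_prop
  refine Eq.trans ?_ (lintegral_sph_const_mul (G v) hm1)
  refine (lintegral_sub_left_eq_self _ v).symm.trans
    (lintegral_congr fun u => lintegral_congr fun σ => ?_)
  rw [cosTheta, vStarPrime, sub_sub_cancel]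
  have : (1 / 2 : ℝ) • (v + (v - u)) - (‖u‖ / 2) • (σ : Vel d) =
      v - (1 / 2 : ℝ) • (u + ((1 : ℝ) * ‖u‖) • (σ : Vel d)) := by module
  rw [this]
  ring

/-- Grazing collisions: a change of variables with Jacobian close to one. -/
lemma gainForm_post_grazing_le (hd : 0 < d) (hγd : -(d : ℝ) < γ) (hw : Measurable w)
    (hm : ∀ e : Sph d, ∫⁻ σ, w (inner ℝ (e : Vel d) (σ : Vel d)) ∂sphMeasure d = m)
    (hmt : m ≠ ∞) {c : ℝ} (hc : 0 < c)
    (hsupp : ∀ t ∈ Icc (-1 : ℝ) 1, w t ≠ 0 → c ^ 2 ≤ (1 + 1 * t) / 2)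
    {G : Vel d → ℝ≥0∞} :
    gainForm γ 1 w (fun x _ => G x) ≤
      ENNReal.ofReal (c ^ (-(d + γ))) * m * ∫⁻ v, G v * collFreq γ v := by
  have h0 : ENNReal.ofReal (c ^ (-(d + γ))) * m ≠ ∞ := ENNReal.mul_ne_top ENNReal.ofReal_ne_top hmt
  rw [gainForm_post measurable_one hw, ← lintegral_const_mul' _ _ h0]
  refine lintegral_mono fun v => ?_
  rw [mul_left_comm]
  gcongr
  rw [collFreq_eq]
  -- Here $v-v_*'=(u+|u|\sigma)/2$, so `s = 1`; keeping the weight $|u|^\gamma$ reproduces $\nu(v)$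
  -- on the right.
  have := lintegral_half_sum_le hd (s := 1) (by norm_num) (a := γ) (by linarith) hc hw hsupp hm hmt
    (fun x => mx (v - x)) (by fun_prop)
  simpa using this

/-- Collisions with small relative speed. -/
lemma gainForm_post_near_le (hγ : γ < 0) (hw : Measurable w)
    (hm : ∀ e : Sph d, ∫⁻ σ, w (inner ℝ (e : Vel d) (σ : Vel d)) ∂sphMeasure d = m)
    {K : ℝ≥0} (hK : ∀ v h : Vel d, ‖h‖ ≤ 1 → mx (v - h) ≤ K * collFreq γ v)
    {r : ℝ} (hr : r ≤ 1) {G : Vel d → ℝ≥0∞} (hG : Measurable G) :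
    gainForm γ (indicator (Iio r) 1) w (fun x _ => G x) ≤
      m * (K * ∫⁻ u in Metric.ball (0 : Vel d) r, ENNReal.ofReal (‖u‖ ^ γ)) *
        ∫⁻ v, G v * collFreq γ v := by
  rw [gainForm_post (measurable_one.indicator measurableSet_Iio) hw,
    ← lintegral_const_mul _ (by fun_prop)]
  refine lintegral_mono fun v => ?_
  rw [mul_left_comm]
  gcongr
  -- Since $|v-v_*'|\le|u|\le1$, the Maxwellian is bounded pointwise by a multiple of $\nu(v)$, so
  -- no change of variables is needed and all angles are allowed.
  calc _ ≤ ∫⁻ u : Vel d, ∫⁻ σ, (ENNReal.ofReal (‖u‖ ^ γ) * w (cosTheta u 0 σ)) *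
        (indicator (Iio r) 1 ‖u‖ * (K * collFreq γ v)) ∂sphMeasure d := by
        refine lintegral_mono fun u => lintegral_mono fun σ => ?_
        by_cases hu : ‖u‖ < r
        · rw [mul_right_comm _ _ (w _), mul_assoc]
          unfold cosTheta
          rw [sub_zero]
          gcongr
          refine hK _ _ ?_
          rw [norm_smul]
          have h1 := norm_add_le u (((1 : ℝ) * ‖u‖) • (σ : Vel d))
          rw [norm_smul, norm_mul, norm_norm, norm_eq_of_mem_sphere] at h1
          norm_num at h1 ⊢
          linarith
        · simp [hu]
    _ = ∫⁻ u : Vel d, (ENNReal.ofReal (‖u‖ ^ γ) * m) *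
        (indicator (Iio r) 1 ‖u‖ * (K * collFreq γ v)) := by
        refine lintegral_congr fun u => ?_
        have hc : Measurable fun σ : Sph d => w (cosTheta u 0 σ) := by
          unfold cosTheta
          fun_prop
        rw [lintegral_mul_const _ (hc.const_mul _), lintegral_const_mul _ hc]
        congr 1
        simpa using lintegral_angular hγ hm u 0
    _ = m * (∫⁻ u in Metric.ball (0 : Vel d) r, ENNReal.ofReal (‖u‖ ^ γ)) *
          (K * collFreq γ v) := by
        rw [← lintegral_indicator Metric.isOpen_ball.measurableSet,
          ← lintegral_const_mul _ ((by fun_prop : Measurable fun u : Vel d =>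
            ENNReal.ofReal (‖u‖ ^ γ)).indicator Metric.isOpen_ball.measurableSet),
          ← lintegral_mul_const _ (((by fun_prop : Measurable fun u : Vel d =>
            ENNReal.ofReal (‖u‖ ^ γ)).indicator Metric.isOpen_ball.measurableSet).const_mul _)]
        refine lintegral_congr fun u => ?_
        by_cases hu : ‖u‖ < r
        · simp [indicator, hu]; ring
        · simp [indicator, hu]
    _ = _ := by ring

lemma gainForm_pre_near_le (hd : 0 < d) (hγ : γ < 0) (hw : Measurable w)
    (hm : ∀ e : Sph d, ∫⁻ σ, w (inner ℝ (e : Vel d) (σ : Vel d)) ∂sphMeasure d = m)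
    {K : ℝ≥0} (hK : ∀ v h : Vel d, ‖h‖ ≤ 1 → mx (v - h) ≤ K * collFreq γ v)
    {r : ℝ} (hr : r ≤ 1) {β : Vel d → ℝ≥0∞} (hβ : Measurable β) :
    gainForm γ (indicator (Iio r) 1) w (fun _ y => β y) ≤
      m * (K * ∫⁻ u in Metric.ball (0 : Vel d) r, ENNReal.ofReal (‖u‖ ^ γ)) *
        ∫⁻ v, β v * collFreq γ v := by
  rw [gainForm_pre hd hγ (measurable_one.indicator measurableSet_Iio) hw hm hβ, mul_assoc]
  gcongr
  rw [← lintegral_const_mul _ (by fun_prop)]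
  refine lintegral_mono fun v => ?_
  rw [mul_left_comm]
  gcongr
  calc _ ≤ ∫⁻ u : Vel d, (Metric.ball (0 : Vel d) r).indicator
        (fun u => ENNReal.ofReal (‖u‖ ^ γ)) u * (K * collFreq γ v) := by
        refine lintegral_mono fun u => ?_
        by_cases hu : ‖u‖ < r
        · simp only [indicator, mem_Iio, hu, if_true, Pi.one_apply, mul_one, Metric.mem_ball,
            dist_zero_right]
          gcongr
          exact hK _ _ (by linarith)
        · simp [hu]
    _ = _ := by
        rw [lintegral_mul_const _ ((by fun_prop : Measurable fun u : Vel d =>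
            ENNReal.ofReal (‖u‖ ^ γ)).indicator Metric.isOpen_ball.measurableSet),
          lintegral_indicator Metric.isOpen_ball.measurableSet]
        ring

/-- Non-grazing collisions with large relative speed have a regularising effect. -/
lemma gainForm_far_le (hd : 0 < d) (hγ : γ < 0) (hw : Measurable w)
    (hm : ∀ e : Sph d, ∫⁻ σ, w (inner ℝ (e : Vel d) (σ : Vel d)) ∂sphMeasure d = m)
    (hmt : m ≠ ∞) {c : ℝ} (hc : 0 < c)
    (hsupp : ∀ t ∈ Icc (-1 : ℝ) 1, w t ≠ 0 → c ^ 2 ≤ (1 + -1 * t) / 2)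
    {K : ℝ≥0} {r : ℝ} (hK : ∀ (t : ℝ) (v w : Vel d), r ≤ t → ‖v - w‖ ≤ t →
      ENNReal.ofReal (t ^ γ) * mx w ≤ K * collFreq γ v)
    {f G : Vel d → ℝ≥0∞} (hf : Measurable f) (hG : Measurable G) :
    gainForm γ (indicator (Ici r) 1) w (fun x y => f y * G x) ≤
      (ENNReal.ofReal (c ^ (-(d : ℝ))) * m * K) * (∫⁻ v, f v) * ∫⁻ v, G v * collFreq γ v := by
  rw [gainForm_swap hd hγ (measurable_one.indicator measurableSet_Ici) hw (by fun_prop),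
    mul_right_comm, mul_comm _ (∫⁻ v, f v), ← lintegral_mul_const _ (by fun_prop)]
  refine lintegral_mono fun v => ?_
  rw [← lintegral_sub_left_eq_self _ v]
  have hmm : Measurable fun q : Vel d × Sph d => ENNReal.ofReal (‖q.1‖ ^ (0 : ℝ)) *
      w (inner ℝ (‖q.1‖⁻¹ • q.1) (q.2 : Vel d)) *
      ((fun x : Vel d => K * (G (v - x) * collFreq γ (v - x)))
        ((1 / 2 : ℝ) • (q.1 + (-1 * ‖q.1‖) • (q.2 : Vel d)))) := by
    simp only
    fun_prop
  calc _ ≤ ∫⁻ u : Vel d, ∫⁻ σ, f v * (ENNReal.ofReal (‖u‖ ^ (0 : ℝ)) *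
          w (inner ℝ (‖u‖⁻¹ • u) (σ : Vel d)) *
          ((fun x : Vel d => K * (G (v - x) * collFreq γ (v - x)))
            ((1 / 2 : ℝ) • (u + (-1 * ‖u‖) • (σ : Vel d))))) ∂sphMeasure d := by
        refine lintegral_mono fun u => lintegral_mono fun σ => ?_
        simp only
        by_cases hu : r ≤ ‖u‖
        · have e1 : vPrime v (v - u) σ = v - (1 / 2 : ℝ) • (u + (-1 * ‖u‖) • (σ : Vel d)) := by
            unfold vPrime
            rw [sub_sub_cancel]
            module
          rw [e1, cosTheta, sub_sub_cancel]
          set v' := v - (1 / 2 : ℝ) • (u + (-1 * ‖u‖) • (σ : Vel d)) with hv'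
          -- From $v'-v_*=(u+|u|\sigma)/2$; the whole factor $|u|^\gamma\mathcal M(v_*)$ is then
          -- absorbed into $K\nu(v')$.
          have h2 : ‖v' - (v - u)‖ ≤ ‖u‖ := by
            have : v' - (v - u) = (1 / 2 : ℝ) • (u + ‖u‖ • (σ : Vel d)) := by
              rw [hv']; module
            rw [this, norm_smul]
            have h1 := norm_add_le u (‖u‖ • (σ : Vel d))
            rw [norm_norm_smul] at h1
            norm_num at h1 ⊢
            linarith
          have h3 := hK ‖u‖ v' (v - u) hu h2
          simp only [indicator, mem_Ici, hu, if_true, Pi.one_apply, mul_one, Real.rpow_zero,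
            ENNReal.ofReal_one, one_mul]
          calc _ = f v * (w (inner ℝ (‖u‖⁻¹ • u) (σ : Vel d)) * (G v' *
                (ENNReal.ofReal (‖u‖ ^ γ) * mx (v - u)))) := by ring
            _ ≤ f v * (w (inner ℝ (‖u‖⁻¹ • u) (σ : Vel d)) * (G v' *
                (K * collFreq γ v'))) := by gcongr
            _ = _ := by ring
        · simp [hu]
    _ = f v * ∫⁻ u : Vel d, ∫⁻ σ, (ENNReal.ofReal (‖u‖ ^ (0 : ℝ)) *
          w (inner ℝ (‖u‖⁻¹ • u) (σ : Vel d)) *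
          ((fun x : Vel d => K * (G (v - x) * collFreq γ (v - x)))
            ((1 / 2 : ℝ) • (u + (-1 * ‖u‖) • (σ : Vel d))))) ∂sphMeasure d :=
        lintegral_sph_const_mul _ hmm
    _ ≤ f v * (ENNReal.ofReal (c ^ (-((d : ℝ) + 0))) * m *
          ∫⁻ u : Vel d, ENNReal.ofReal (‖u‖ ^ (0 : ℝ)) *
            (K * (G (v - u) * collFreq γ (v - u)))) := by
        gcongr
        -- Now $v-v'=(u-|u|\sigma)/2$, hence `s = -1`, and no power of $|u|$ is left, hence `a = 0`.
        exact lintegral_half_sum_le hd (s := -1) (by norm_num) (a := 0) (by positivity) hc hw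
          hsupp hm hmt _ (by fun_prop)
    _ = _ := by
        simp only [Real.rpow_zero, ENNReal.ofReal_one, one_mul, add_zero]
        rw [lintegral_const_mul _ (by fun_prop),
          lintegral_sub_left_eq_self (fun x => G x * collFreq γ x) v]
        ring

end GainForm

/-! ### Domination of the gain by the loss, uniformly in the angular kernel. -/

section GainEstimate

variable {d : ℕ} {γ : ℝ} {b : ℝ → ℝ}

lemma exists_lintegral_zonal (w : ℝ → ℝ≥0∞) : ∃ m : ℝ≥0∞, ∀ e : Sph d,
    ∫⁻ σ, w (inner ℝ (e : Vel d) (σ : Vel d)) ∂sphMeasure d = m := by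
  rcases isEmpty_or_nonempty (Sph d) with h | ⟨⟨e₀⟩⟩
  · exact ⟨0, fun e => (h.false e).elim⟩
  · exact ⟨_, fun e => lintegral_zonal w e e₀⟩

/-- By evenness of the angular kernel, at most half of the collisions are grazing. -/
lemma IsAngularKernel.lintegral_Ioi_le (hb : IsAngularKernel d b) {s₀ : ℝ} (hs : 0 ≤ s₀)
    (e : Sph d) :
    ∫⁻ σ, (Ioi s₀).indicator (fun s => ENNReal.ofReal (b s)) (inner ℝ (e : Vel d) (σ : Vel d))
      ∂sphMeasure d ≤ 1 / 2 := by
  set w : ℝ → ℝ≥0∞ := (Ioi s₀).indicator (fun s => ENNReal.ofReal (b s)) with hw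
  have hwm : Measurable w := (hb.measurable.ennreal_ofReal).indicator measurableSet_Ioi
  have h1 : ∫⁻ σ, w (-inner ℝ (e : Vel d) (σ : Vel d)) ∂sphMeasure d =
      ∫⁻ σ, w (inner ℝ (e : Vel d) (σ : Vel d)) ∂sphMeasure d := by
    rw [← lintegral_sphMap (LinearIsometryEquiv.neg ℝ)
      (fun σ : Sph d => w (inner ℝ (e : Vel d) (σ : Vel d)))]
    simp
  -- As `s₀ ≥ 0`, the sets $\{t>s_0\}$ and $\{-t>s_0\}$ are disjoint; by evenness of `b` they carry
  -- equal mass, together at most `1`.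
  have h2 : (∫⁻ σ, w (inner ℝ (e : Vel d) (σ : Vel d)) ∂sphMeasure d) +
      ∫⁻ σ, w (inner ℝ (e : Vel d) (σ : Vel d)) ∂sphMeasure d ≤ 1 := by
    nth_rewrite 2 [← h1]
    rw [← lintegral_add_left (measurable_zonal hwm e), ← hb.mass e]
    refine lintegral_mono fun σ => ?_
    have ht := inner_sph_mem e σ
    set t : ℝ := inner ℝ (e : Vel d) (σ : Vel d)
    simp only [hw, indicator, mem_Ioi]
    split_ifs with h3 h4 h4
    · linarith
    · simp
    · rw [hb.even t ht]; simp
    · simp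
  rw [ENNReal.le_div_iff_mul_le (by simp) (by simp), mul_two]
  exact h2

/-- With $c=\cos(\theta_0/2)$ close to `1`, the Jacobian factor stays below $3/2$, while $c^2\ge1/2$
keeps the threshold $\cos\theta_0$ non-negative, as the evenness argument requires. -/
lemma exists_grazing_angle {a : ℝ} :
    ∃ c : ℝ, 0 < c ∧ c < 1 ∧ 1 / 2 ≤ c ^ 2 ∧ c ^ (-a) ≤ 3 / 2 := by
  have h1 : Tendsto (fun c : ℝ => c ^ (-a)) (𝓝 1) (𝓝 1) := by
    have := (Real.continuousAt_rpow_const 1 (-a) (Or.inl one_ne_zero)).tendsto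
    simpa using this
  have h2 : Tendsto (fun c : ℝ => c ^ 2) (𝓝 1) (𝓝 1) := by
    simpa using ((continuous_pow 2).tendsto (1 : ℝ))
  have h3 : ∀ᶠ c : ℝ in 𝓝[<] 1, 0 < c ∧ c < 1 ∧ 1 / 2 ≤ c ^ 2 ∧ c ^ (-a) ≤ 3 / 2 := by
    filter_upwards [(lt_mem_nhds (zero_lt_one' ℝ)).filter_mono nhdsWithin_le_nhds,
      self_mem_nhdsWithin,
      (h2.eventually_const_le (by norm_num : (1 / 2 : ℝ) < 1)).filter_mono nhdsWithin_le_nhds,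
      (h1.eventually_le_const (by norm_num : (1 : ℝ) < 3 / 2)).filter_mono nhdsWithin_le_nhds]
      with c h1 h2 h3 h4
    exact ⟨h1, h2, h3, h4⟩
  exact h3.exists

/-- The central estimate: the gain part is dominated by the loss part up to a term which is
controlled by the mass, with constants independent of the angular kernel. -/
theorem exists_gainForm_le (hd : 0 < d) (hγd : -(d : ℝ) < γ) (hγ : γ < 0) :
    ∃ A K : ℝ≥0, ∀ b : ℝ → ℝ, IsAngularKernel d b → ∀ f φ β G : Vel d → ℝ≥0∞,
      Measurable f → Measurable φ → Measurable β → Measurable G →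
      (∀ x y, φ x * f y ≤ β y + G x) → ∀ η θ : ℝ≥0∞, (∀ x, φ x ≤ η * G x + θ) →
      gainForm γ 1 (fun s => ENNReal.ofReal (b s)) (fun x y => φ x * f y) ≤
        7 / 8 * ((∫⁻ v, β v * collFreq γ v) + ∫⁻ v, G v * collFreq γ v) +
          η * A * (∫⁻ v, f v) * (∫⁻ v, G v * collFreq γ v) + θ * K * ∫⁻ v, f v := by
  obtain ⟨c, hc0, hc1, hc2, hc3⟩ := exists_grazing_angle (a := d + γ)
  obtain ⟨K₀, hK₀⟩ := exists_collFreq_le hd hγd hγ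
  obtain ⟨K₁, hK₁⟩ := exists_mx_shift_le (γ := γ) hd hγ
  -- The choice $1/8$ gives $3/4+1/8=7/8$ and leaves $1/8$ for absorbing the regular part.
  obtain ⟨r, hr0, hr1, hr⟩ := exists_radius_small hd hγd K₁ (ε := 1 / 8) (by simp)
  obtain ⟨K₂, hK₂⟩ := exists_far_le (γ := γ) hd hγ hr0
  have hc' : 0 < 1 - c ^ 2 := by nlinarith
  -- The lower bound for $\sin(\theta/2)$ on non-grazing collisions, where $\cos^2(\theta/2)\le
  -- c^2$.
  set c₂ := Real.sqrt (1 - c ^ 2) with hc₂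
  have hc₂0 : 0 < c₂ := Real.sqrt_pos.2 hc'
  have hc₂s : c₂ ^ 2 = 1 - c ^ 2 := Real.sq_sqrt hc'.le
  refine ⟨(c₂ ^ (-(d : ℝ))).toNNReal * K₂, K₀, fun b hb f φ β G hf hφ hβ hG hY1 η θ hY2 => ?_⟩
  set B : ℝ → ℝ≥0∞ := fun s => ENNReal.ofReal (b s) with hB
  have hBm : Measurable B := hb.measurable.ennreal_ofReal
  -- The cosine of the threshold angle: $\cos\theta>s_0$ means $\cos^2(\theta/2)>c^2$.
  set s₀ := 2 * c ^ 2 - 1 with hs₀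
  set w₁ := (Ioi s₀).indicator B with hw₁
  set w₂ := (Iic s₀).indicator B with hw₂
  have hw₁m : Measurable w₁ := hBm.indicator measurableSet_Ioi
  have hw₂m : Measurable w₂ := hBm.indicator measurableSet_Iic
  obtain ⟨m₁, hm₁⟩ := exists_lintegral_zonal (d := d) w₁
  obtain ⟨m₂, hm₂⟩ := exists_lintegral_zonal (d := d) w₂
  have : NeZero d := ⟨hd.ne'⟩
  obtain ⟨e⟩ : Nonempty (Sph d) := (NormedSpace.sphere_nonempty.2 zero_le_one).to_subtype
  have hm₁le : m₁ ≤ 1 / 2 := by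
    rw [← hm₁ e]; exact hb.lintegral_Ioi_le (by linarith) e
  have hm₂le : m₂ ≤ 1 := by
    rw [← hm₂ e, ← hb.mass e]
    exact lintegral_mono fun σ => indicator_le_self _ _ _
  have hm₁t : m₁ ≠ ∞ := ne_top_of_le_ne_top (by simp) hm₁le
  have hm₂t : m₂ ≠ ∞ := ne_top_of_le_ne_top (by simp) hm₂le
  set near : ℝ → ℝ≥0∞ := indicator (Iio r) 1 with hnear
  set far : ℝ → ℝ≥0∞ := indicator (Ici r) 1 with hfar
  have hnm : Measurable near := measurable_one.indicator measurableSet_Iio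
  have hfm : Measurable far := measurable_one.indicator measurableSet_Ici
  set X := ∫⁻ v, f v with hX
  set Iβ := ∫⁻ v, β v * collFreq γ v with hIβ
  set IG := ∫⁻ v, G v * collFreq γ v with hIG
  have hΦm : Measurable fun q : Vel d × Vel d => φ q.1 * f q.2 := by fun_prop
  have hβm : Measurable fun q : Vel d × Vel d => β q.2 := by fun_prop
  -- grazing collisions
  have h1 : gainForm γ 1 w₁ (fun x y => φ x * f y) ≤ 3 / 4 * (Iβ + IG) := by
    calc _ ≤ gainForm γ 1 w₁ (fun x y => β y + G x) :=
          gainForm_mono (fun _ => le_rfl) (fun _ => le_rfl) hY1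
      _ = gainForm γ 1 w₁ (fun _ y => β y) + gainForm γ 1 w₁ (fun x _ => G x) :=
          gainForm_add measurable_one hw₁m hβm
      _ ≤ m₁ * Iβ + ENNReal.ofReal (c ^ (-(d + γ))) * m₁ * IG := by
          gcongr
          · rw [gainForm_pre hd hγ measurable_one hw₁m hm₁ hβ]
            simp_rw [hIβ, collFreq_eq, Pi.one_apply, mul_one, le_refl]
          · refine gainForm_post_grazing_le hd hγd hw₁m hm₁ hm₁t hc0 fun t _ ht => ?_
            have : t ∈ Ioi s₀ := by
              by_contra h
              exact ht (indicator_of_notMem h _)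
            rw [mem_Ioi] at this
            linarith
      _ ≤ 3 / 4 * Iβ + 3 / 4 * IG := by
          gcongr
          · refine hm₁le.trans ?_
            rw [← ENNReal.toReal_le_toReal (by simp) (by finiteness)]
            norm_num
          · calc ENNReal.ofReal (c ^ (-(d + γ))) * m₁ ≤ ENNReal.ofReal (3 / 2) * (1 / 2) := by
                  gcongr
              _ ≤ 3 / 4 := by
                  rw [← ENNReal.toReal_le_toReal (by finiteness) (by finiteness)]
                  norm_num
      _ = _ := by ring
  -- small relative speeds
  have h2 : gainForm γ near w₂ (fun x y => φ x * f y) ≤ 1 / 8 * (Iβ + IG) := by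
    have hm8 : m₂ * (K₁ * ∫⁻ u in Metric.ball (0 : Vel d) r, ENNReal.ofReal (‖u‖ ^ γ)) ≤ 1 / 8 :=
      (mul_le_mul' hm₂le hr).trans (by rw [one_mul])
    calc _ ≤ gainForm γ near w₂ (fun x y => β y + G x) :=
          gainForm_mono (fun _ => le_rfl) (fun _ => le_rfl) hY1
      _ = gainForm γ near w₂ (fun _ y => β y) + gainForm γ near w₂ (fun x _ => G x) :=
          gainForm_add hnm hw₂m hβm
      _ ≤ 1 / 8 * Iβ + 1 / 8 * IG := by
          refine add_le_add ?_ ?_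
          · exact (gainForm_pre_near_le hd hγ hw₂m hm₂ hK₁ hr1 hβ).trans (by gcongr)
          · exact (gainForm_post_near_le hγ hw₂m hm₂ hK₁ hr1 hG).trans (by gcongr)
      _ = _ := by ring
  -- regularising collisions
  have h3 : gainForm γ far w₂ (fun x y => φ x * f y) ≤
      η * ((c₂ ^ (-(d : ℝ))).toNNReal * K₂ : ℝ≥0) * X * IG + θ * K₀ * X := by
    calc _ ≤ gainForm γ far w₂ (fun x y => f y * (η * G x) + θ * f y) := by
          -- Young's inequality between $\varphi$ and $f$ is not used here: splitting $\varphi$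
          -- alone keeps a factor $f(v')$, which the regularising change of variables integrates to
          -- the mass.
          refine gainForm_mono (fun _ => le_rfl) (fun _ => le_rfl) fun x y => ?_
          calc φ x * f y ≤ (η * G x + θ) * f y := by gcongr; exact hY2 x
            _ = _ := by ring
      _ = gainForm γ far w₂ (fun x y => f y * (η * G x)) + gainForm γ far w₂ (fun _ y => θ * f y) :=
          gainForm_add hfm hw₂m (by fun_prop)
      _ ≤ (ENNReal.ofReal (c₂ ^ (-(d : ℝ))) * m₂ * K₂) * X * (∫⁻ v, η * G v * collFreq γ v) +
            m₂ * ∫⁻ v, θ * f v * collFreq γ v := by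
          refine add_le_add ?_ ?_
          · refine gainForm_far_le hd hγ hw₂m hm₂ hm₂t hc₂0 (fun t _ ht => ?_) hK₂ hf
              (hG.const_mul _)
            have : t ∈ Iic s₀ := by
              by_contra h
              exact ht (indicator_of_notMem h _)
            rw [mem_Iic] at this
            linarith
          · calc gainForm γ far w₂ (fun _ y => θ * f y) ≤ gainForm γ 1 w₂ (fun _ y => θ * f y) :=
                  gainForm_mono (fun _ => indicator_le_self _ _ _) (fun _ => le_rfl)
                    (fun _ _ => le_rfl)
              _ = _ := by
                  rw [gainForm_pre hd hγ measurable_one hw₂m hm₂ (hf.const_mul θ)]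
                  simp_rw [collFreq_eq, Pi.one_apply, mul_one]
      _ ≤ (ENNReal.ofReal (c₂ ^ (-(d : ℝ))) * 1 * K₂) * X * (η * IG) + 1 * (θ * (X * K₀)) := by
          gcongr
          · simp_rw [mul_assoc]
            rw [lintegral_const_mul _ (by fun_prop)]
          · simp_rw [mul_assoc]
            rw [lintegral_const_mul _ (by fun_prop), hX, ← lintegral_mul_const _ hf]
            gcongr with v
            exact hK₀ v
      _ = _ := by
          rw [ENNReal.coe_mul]
          change _ = η * (ENNReal.ofReal _ * K₂) * X * IG + _
          ring
  calc _ ≤ gainForm γ 1 w₁ (fun x y => φ x * f y) + gainForm γ 1 w₂ (fun x y => φ x * f y) := by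
        refine gainForm_add_weight measurable_one hw₁m hΦm fun t s => ?_
        simp only [hw₁, hw₂, Pi.one_apply, one_mul, indicator, mem_Ioi, mem_Iic]
        split_ifs with h h' h'
        · exact le_self_add
        · simp
        · simp
        · exact (h' (not_lt.1 h)).elim
    _ ≤ gainForm γ 1 w₁ (fun x y => φ x * f y) + (gainForm γ near w₂ (fun x y => φ x * f y) +
          gainForm γ far w₂ (fun x y => φ x * f y)) := by
        gcongr
        refine gainForm_add_weight hnm hw₂m hΦm fun t s => ?_
        simp only [hnear, hfar, indicator, mem_Iio, mem_Ici]
        split_ifs with h h' h'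
        · simp
        · simp
        · simp
        · exact (h' (not_lt.1 h)).elim
    _ ≤ 3 / 4 * (Iβ + IG) + (1 / 8 * (Iβ + IG) + (η * ((c₂ ^ (-(d : ℝ))).toNNReal * K₂ : ℝ≥0) * X * IG
          + θ * K₀ * X)) := by gcongr
    _ = (3 / 4 + 1 / 8) * (Iβ + IG) + η * ((c₂ ^ (-(d : ℝ))).toNNReal * K₂ : ℝ≥0) * X * IG
          + θ * K₀ * X := by ring
    _ = _ := by
        have : (3 / 4 + 1 / 8 : ℝ≥0∞) = 7 / 8 := by
          rw [← ENNReal.toReal_eq_toReal_iff' (by finiteness) (by finiteness),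
            ENNReal.toReal_add (by finiteness) (by finiteness)]
          norm_num
        rw [this]

end GainEstimate

/-! ### The power function linearised beyond a threshold, and its Young inequalities. -/

section Truncation

/-- Truncation of a real number to `[0, n]`. -/
def trunc (n s : ℝ) : ℝ := min (max s 0) n

/-- The function `s ^ p` on `[0, n]`, continued by its tangent at `n`. -/
def truncPow (p n s : ℝ) : ℝ := trunc n s ^ p + p * trunc n s ^ (p - 1) * (s - trunc n s)

/-- The derivative of `truncPow`. -/
def truncDeriv (p n s : ℝ) : ℝ := p * trunc n s ^ (p - 1)

variable {p n : ℝ}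

lemma trunc_nonneg (hn : 0 < n) (s : ℝ) : 0 ≤ trunc n s := le_min (le_max_right _ _) hn.le

lemma trunc_le (s : ℝ) : trunc n s ≤ n := min_le_right _ _

lemma trunc_le_self {s : ℝ} (hs : 0 ≤ s) : trunc n s ≤ s := by
  rw [trunc, max_eq_left hs]; exact min_le_left _ _

lemma continuous_trunc : Continuous (trunc n) := by unfold trunc; fun_prop

lemma continuous_truncDeriv (hp : 1 < p) : Continuous (truncDeriv p n) := by
  unfold truncDeriv
  exact continuous_const.mul (continuous_trunc.rpow_const fun _ => Or.inr (by linarith))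

lemma continuous_truncPow (hp : 1 < p) : Continuous (truncPow p n) := by
  unfold truncPow
  have h1 : Continuous fun s => trunc n s ^ p :=
    continuous_trunc.rpow_const fun _ => Or.inr (by linarith)
  have h2 : Continuous fun s => trunc n s ^ (p - 1) :=
    continuous_trunc.rpow_const fun _ => Or.inr (by linarith)
  have h3 : Continuous (trunc n) := continuous_trunc
  fun_prop

lemma truncDeriv_nonneg (hp : 1 < p) (hn : 0 < n) (s : ℝ) : 0 ≤ truncDeriv p n s :=
  mul_nonneg (by linarith) (Real.rpow_nonneg (trunc_nonneg hn s) _)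

lemma truncDeriv_le (hp : 1 < p) (hn : 0 < n) (s : ℝ) : truncDeriv p n s ≤ p * n ^ (p - 1) :=
  mul_le_mul_of_nonneg_left (Real.rpow_le_rpow (trunc_nonneg hn s) (trunc_le s) (by linarith))
    (by linarith)

/-- Young's inequality with exponents $p/(p-1)$ and $p$ for $a^{p-1}$ and $c$, multiplied by $p$. -/
lemma young_rpow (hp : 1 < p) {a c : ℝ} (ha : 0 ≤ a) (hc : 0 ≤ c) :
    p * a ^ (p - 1) * c ≤ (p - 1) * a ^ p + c ^ p := by
  have hpq : (p / (p - 1)).HolderConjugate p := (Real.HolderConjugate.conjExponent hp).symm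
  have h := Real.young_inequality_of_nonneg (Real.rpow_nonneg ha (p - 1)) hc hpq
  rw [← Real.rpow_mul ha] at h
  have hp1 : p - 1 ≠ 0 := by linarith
  have h1 : (p - 1) * (p / (p - 1)) = p := by field_simp
  rw [h1] at h
  have h2 := mul_le_mul_of_nonneg_left h (by linarith : 0 ≤ p)
  have h3 : p * (a ^ p / (p / (p - 1)) + c ^ p / p) = (p - 1) * a ^ p + c ^ p := by field_simp
  rw [h3] at h2
  linarith

lemma rpow_eq_mul_rpow_sub_one (hp : 1 < p) {a : ℝ} (ha : 0 ≤ a) : a ^ p = a ^ (p - 1) * a := by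
  rw [← Real.rpow_add_one' ha (by linarith)]; simp

/-- The equality case of `truncDeriv_mul_le`. It splits the loss term into exactly the two terms
that Young's inequality produces from the gain. -/
lemma truncPow_add (hp : 1 < p) (hn : 0 < n) (s : ℝ) :
    truncPow p n s + (p - 1) * trunc n s ^ p = truncDeriv p n s * s := by
  rw [truncPow, truncDeriv, rpow_eq_mul_rpow_sub_one hp (trunc_nonneg hn s)]
  ring

lemma trunc_rpow_le_truncPow (hp : 1 < p) (hn : 0 < n) {s : ℝ} (hs : 0 ≤ s) :
    trunc n s ^ p ≤ truncPow p n s := by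
  have := mul_nonneg (truncDeriv_nonneg hp hn s) (sub_nonneg.2 (trunc_le_self (n := n) hs))
  rw [truncPow, ← truncDeriv]
  linarith

lemma truncPow_nonneg (hp : 1 < p) (hn : 0 < n) {s : ℝ} (hs : 0 ≤ s) : 0 ≤ truncPow p n s :=
  (Real.rpow_nonneg (trunc_nonneg hn s) _).trans (trunc_rpow_le_truncPow hp hn hs)

lemma truncPow_le_rpow (hp : 1 < p) (hn : 0 < n) {s : ℝ} (hs : 0 ≤ s) :
    truncPow p n s ≤ s ^ p := by
  have h1 := truncPow_add hp hn s
  have h2 := young_rpow hp (trunc_nonneg hn s) hs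
  rw [truncDeriv] at h1
  linarith

/-- Young's inequality for `truncPow`. -/
lemma truncDeriv_mul_le (hp : 1 < p) (hn : 0 < n) (x : ℝ) {y : ℝ} (hy : 0 ≤ y) :
    truncDeriv p n x * y ≤ truncPow p n y + (p - 1) * trunc n x ^ p := by
  have hx0 := trunc_nonneg hn x
  rcases le_total y n with h | h
  · have : trunc n y = y := by rw [trunc, max_eq_left hy, min_eq_left h]
    rw [truncPow, this, truncDeriv]
    have := young_rpow hp hx0 hy
    linarith
  · have : trunc n y = n := by rw [trunc, max_eq_left hy, min_eq_right h]
    rw [truncPow, this]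
    -- Beyond `n` both sides are affine in `y`: Young's inequality at `n`, then comparison of
    -- slopes, the larger being $pn^{p-1}$.
    have h1 := young_rpow hp hx0 hn.le
    have h2 := mul_le_mul_of_nonneg_right (truncDeriv_le hp hn x) (sub_nonneg.2 h)
    rw [truncDeriv] at h2 ⊢
    linarith

/-- Convexity in tangent-line form: Young's inequality minus its equality case. -/
lemma truncPow_sub_le (hp : 1 < p) (hn : 0 < n) {x : ℝ} (hx : 0 ≤ x) (y : ℝ) :
    truncPow p n y - truncPow p n x ≤ truncDeriv p n y * (y - x) := by
  have h1 := truncDeriv_mul_le hp hn y hx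
  have h2 := truncPow_add hp hn y
  linarith

/-- Linear growth makes the truncated functional finite on non-negative $L^1$ functions. -/
lemma truncPow_le_mul (hp : 1 < p) (hn : 0 < n) {s : ℝ} (hs : 0 ≤ s) :
    truncPow p n s ≤ p * n ^ (p - 1) * s := by
  have h1 := truncPow_add hp hn s
  have h2 := mul_le_mul_of_nonneg_right (truncDeriv_le hp hn s) hs
  have h3 : 0 ≤ (p - 1) * trunc n s ^ p :=
    mul_nonneg (by linarith) (Real.rpow_nonneg (trunc_nonneg hn s) _)
  linarith

/-- Young's inequality for $h\cdot$`trunc n s` and the constant `1`, divided by $h^{p-1}$. The free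
parameter `h` makes the first term absorbable. -/
lemma truncDeriv_le_add (hp : 1 < p) (hn : 0 < n) {h : ℝ} (hh : 0 < h) (s : ℝ) :
    truncDeriv p n s ≤ h * ((p - 1) * trunc n s ^ p) + h ^ (-(p - 1)) := by
  have hx0 := trunc_nonneg hn s
  have h1 := young_rpow hp (mul_nonneg hh.le hx0) zero_le_one
  rw [Real.mul_rpow hh.le hx0, Real.mul_rpow hh.le hx0, Real.one_rpow, mul_one,
    rpow_eq_mul_rpow_sub_one hp hh.le] at h1
  have h2 : 0 < h ^ (-(p - 1)) := Real.rpow_pos_of_pos hh _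
  have h3 : h ^ (-(p - 1)) * h ^ (p - 1) = 1 := by
    rw [← Real.rpow_add hh]; simp
  have h4 := mul_le_mul_of_nonneg_left h1 h2.le
  rw [truncDeriv]
  calc p * trunc n s ^ (p - 1) = (h ^ (-(p - 1)) * h ^ (p - 1)) * (p * trunc n s ^ (p - 1)) := by
        rw [h3, one_mul]
    _ = h ^ (-(p - 1)) * (p * (h ^ (p - 1) * trunc n s ^ (p - 1))) := by ring
    _ ≤ _ := h4
    _ = (h ^ (-(p - 1)) * h ^ (p - 1)) * (h * ((p - 1) * trunc n s ^ p)) + h ^ (-(p - 1)) := by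
        ring
    _ = _ := by rw [h3, one_mul]

end Truncation

/-! ### The linear Boltzmann operator on $L^1$. -/

section Operator

variable {d : ℕ} {γ : ℝ} {b : ℝ → ℝ}

instance : SFinite ((volume : Measure (Vel d)).prod (sphMeasure d)) := Measure.prod.instSFinite

lemma measurable_section {α β δ : Type*} [MeasurableSpace α] [MeasurableSpace β]
    [MeasurableSpace δ] {F : α × β → δ} (hF : Measurable F) (a : α) :
    Measurable fun x => F (a, x) :=
  hF.comp measurable_prodMk_left

/-- The collision kernel `|v - v_*|^γ b(cos θ)`. -/
def collKernel (γ : ℝ) (b : ℝ → ℝ) (v : Vel d) (x : Vel d × Sph d) : ℝ :=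
  ‖v - x.1‖ ^ γ * b (cosTheta v x.1 x.2)

/-- The gain part of the linear Boltzmann operator. -/
def gainOp (γ : ℝ) (b : ℝ → ℝ) (f : Vel d → ℝ) (v : Vel d) : ℝ :=
  ∫ x : Vel d × Sph d, collKernel γ b v x *
    (f (vPrime v x.1 x.2) * maxwellian d (vStarPrime v x.1 x.2))
    ∂((volume : Measure (Vel d)).prod (sphMeasure d))

lemma cosTheta_mem (v w : Vel d) (σ : Sph d) : cosTheta v w σ ∈ Icc (-1 : ℝ) 1 := by
  by_cases h : v - w = 0
  · simp [cosTheta, h]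
  · exact inner_sph_mem ⟨‖v - w‖⁻¹ • (v - w), by
      rw [mem_sphere_zero_iff_norm, norm_smul, norm_inv, norm_norm,
        inv_mul_cancel₀ (norm_ne_zero_iff.2 h)]⟩ σ

lemma collKernel_nonneg (hb : IsAngularKernel d b) (v : Vel d) (x : Vel d × Sph d) :
    0 ≤ collKernel γ b v x :=
  mul_nonneg (Real.rpow_nonneg (norm_nonneg _) _) (hb.nonneg _ (cosTheta_mem _ _ _))

lemma measurable_collKernel (hb : IsAngularKernel d b) :
    Measurable fun q : Vel d × Vel d × Sph d => collKernel γ b q.1 q.2 := by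
  unfold collKernel
  have h1 : Measurable fun q : Vel d × Vel d × Sph d => b (cosTheta q.1 q.2.1 q.2.2) :=
    hb.measurable.comp measurable_cosTheta
  have h2 : Measurable fun q : Vel d × Vel d × Sph d => ‖q.1 - q.2.1‖ ^ γ := by fun_prop
  exact h2.mul h1

lemma enorm_collKernel (hb : IsAngularKernel d b) (v w : Vel d) (σ : Sph d) :
    ‖collKernel γ b v (w, σ)‖ₑ =
      ENNReal.ofReal (‖v - w‖ ^ γ) * (1 : ℝ → ℝ≥0∞) ‖v - w‖ *
        ENNReal.ofReal (b (cosTheta v w σ)) := by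
  rw [Real.enorm_eq_ofReal (collKernel_nonneg hb _ _), collKernel,
    ENNReal.ofReal_mul (Real.rpow_nonneg (norm_nonneg _) _)]
  simp

lemma enorm_maxwellian (v : Vel d) : ‖maxwellian d v‖ₑ = mx v :=
  Real.enorm_eq_ofReal (maxwellian_pos v).le

lemma measurable_gainOp_integrand (hb : IsAngularKernel d b) {f : Vel d → ℝ} (hf : Measurable f) :
    Measurable fun q : Vel d × Vel d × Sph d => collKernel γ b q.1 q.2 *
      (f (vPrime q.1 q.2.1 q.2.2) * maxwellian d (vStarPrime q.1 q.2.1 q.2.2)) :=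
  (measurable_collKernel hb).mul ((hf.comp measurable_vPrime).mul
    (continuous_maxwellian.measurable.comp measurable_vStarPrime))

/-- The gain form is an iterated integral over the velocity and the collision parameters. -/
lemma gainForm_eq (hb : IsAngularKernel d b) {ψ : Vel d → ℝ≥0∞} {f : Vel d → ℝ}
    (hf : Measurable f) :
    gainForm γ 1 (fun s => ENNReal.ofReal (b s)) (fun x y => ψ x * ‖f y‖ₑ) =
      ∫⁻ v, ψ v * ∫⁻ x : Vel d × Sph d, ‖collKernel γ b v x *
        (f (vPrime v x.1 x.2) * maxwellian d (vStarPrime v x.1 x.2))‖ₑ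
        ∂((volume : Measure (Vel d)).prod (sphMeasure d)) := by
  refine lintegral_congr fun v => ?_
  have hm := (measurable_gainOp_integrand (γ := γ) hb hf).enorm
  have hm1 : Measurable fun x : Vel d × Sph d => ‖collKernel γ b v x *
        (f (vPrime v x.1 x.2) * maxwellian d (vStarPrime v x.1 x.2))‖ₑ :=
    measurable_section hm v
  rw [lintegral_prod _ hm1.aemeasurable, ← lintegral_sph_const_mul (ψ v)
    (F := fun w σ => ‖collKernel γ b v (w, σ) *
        (f (vPrime v w σ) * maxwellian d (vStarPrime v w σ))‖ₑ) hm1]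
  refine lintegral_congr fun w => lintegral_congr fun σ => ?_
  simp only [enorm_mul, enorm_collKernel hb, enorm_maxwellian]
  ring

lemma gainForm_one_eq (hd : 0 < d) (hγ : γ < 0) (hb : IsAngularKernel d b) {g : Vel d → ℝ≥0∞}
    (hg : Measurable g) :
    gainForm γ 1 (fun s => ENNReal.ofReal (b s)) (fun _ y => g y) =
      ∫⁻ v : Vel d, g v * collFreq γ v := by
  rw [gainForm_pre hd hγ measurable_one hb.measurable.ennreal_ofReal hb.mass hg, one_mul]
  simp_rw [collFreq_eq, Pi.one_apply, mul_one]

lemma lintegral_gain_eq (hd : 0 < d) (hγ : γ < 0) (hb : IsAngularKernel d b) {f : Vel d → ℝ}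
    (hf : Measurable f) :
    ∫⁻ v, ∫⁻ x : Vel d × Sph d, ‖collKernel γ b v x *
        (f (vPrime v x.1 x.2) * maxwellian d (vStarPrime v x.1 x.2))‖ₑ
        ∂((volume : Measure (Vel d)).prod (sphMeasure d)) = ∫⁻ v, ‖f v‖ₑ * collFreq γ v := by
  rw [← gainForm_one_eq hd hγ hb hf.enorm]
  have := gainForm_eq (γ := γ) hb hf (ψ := 1)
  simp only [Pi.one_apply, one_mul] at this
  exact this.symm

variable {K : ℝ≥0}

lemma lintegral_mul_collFreq_le (hK : ∀ v : Vel d, collFreq γ v ≤ K) {g : Vel d → ℝ≥0∞}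
    (hg : Measurable g) : ∫⁻ v, g v * collFreq γ v ≤ (∫⁻ v, g v) * K := by
  rw [← lintegral_mul_const _ hg]
  gcongr with v
  exact hK v

/-- The total gain equals the total loss, which is finite. Integrability is what allows the single
Bochner integral in `collision` to be split into gain and loss, since a non-integrable one would
default to `0`. -/
lemma ae_integrable_gain (hd : 0 < d) (hγ : γ < 0) (hK : ∀ v : Vel d, collFreq γ v ≤ K)
    (hb : IsAngularKernel d b) {f : Vel d → ℝ} (hf : Measurable f) (hfi : Integrable f) :
    ∀ᵐ v, Integrable (fun x : Vel d × Sph d => collKernel γ b v x *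
        (f (vPrime v x.1 x.2) * maxwellian d (vStarPrime v x.1 x.2)))
        ((volume : Measure (Vel d)).prod (sphMeasure d)) := by
  have hm := measurable_gainOp_integrand (γ := γ) hb hf
  have h1 : ∫⁻ v, ∫⁻ x : Vel d × Sph d, ‖collKernel γ b v x *
        (f (vPrime v x.1 x.2) * maxwellian d (vStarPrime v x.1 x.2))‖ₑ
        ∂((volume : Measure (Vel d)).prod (sphMeasure d)) ≠ ∞ := by
    rw [lintegral_gain_eq hd hγ hb hf]
    exact ne_top_of_le_ne_top (ENNReal.mul_ne_top hfi.2.ne ENNReal.coe_ne_top)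
      (lintegral_mul_collFreq_le hK hf.enorm)
  filter_upwards [ae_lt_top hm.enorm.lintegral_prod_right' h1] with v hv
  exact ⟨(measurable_section hm v).aestronglyMeasurable, hv⟩

lemma lintegral_loss (hγ : γ < 0) (hb : IsAngularKernel d b) (v : Vel d) :
    ∫⁻ x : Vel d × Sph d, ‖collKernel γ b v x * maxwellian d x.1‖ₑ
      ∂((volume : Measure (Vel d)).prod (sphMeasure d)) = collFreq γ v := by
  have hm : Measurable fun x : Vel d × Sph d => ‖collKernel γ b v x * maxwellian d x.1‖ₑ :=
    ((measurable_section (measurable_collKernel hb) v).mul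
      (continuous_maxwellian.measurable.comp measurable_fst)).enorm
  rw [lintegral_prod _ hm.aemeasurable, collFreq]
  refine lintegral_congr fun w => ?_
  have hc : Measurable fun σ : Sph d => ENNReal.ofReal (b (cosTheta v w σ)) := by
    refine (hb.measurable.comp ?_).ennreal_ofReal
    unfold cosTheta
    fun_prop
  simp only [enorm_mul, enorm_collKernel hb, enorm_maxwellian, Pi.one_apply, mul_one]
  rw [lintegral_mul_const _ (hc.const_mul _), lintegral_const_mul _ hc,
    lintegral_angular (w := fun s => ENNReal.ofReal (b s)) hγ hb.mass v w, mul_one]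

lemma integrable_loss (hγ : γ < 0) (hK : ∀ v : Vel d, collFreq γ v ≤ K)
    (hb : IsAngularKernel d b) (v : Vel d) :
    Integrable (fun x : Vel d × Sph d => collKernel γ b v x * maxwellian d x.1)
      ((volume : Measure (Vel d)).prod (sphMeasure d)) := by
  refine ⟨((measurable_section (measurable_collKernel hb) v).mul
      (continuous_maxwellian.measurable.comp measurable_fst)).aestronglyMeasurable, ?_⟩
  rw [HasFiniteIntegral, lintegral_loss hγ hb]
  exact (hK v).trans_lt ENNReal.coe_lt_top

lemma integral_loss (hγ : γ < 0) (hb : IsAngularKernel d b) (v : Vel d) :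
    ∫ x : Vel d × Sph d, collKernel γ b v x * maxwellian d x.1
      ∂((volume : Measure (Vel d)).prod (sphMeasure d)) = (collFreq γ v).toReal := by
  rw [← lintegral_loss hγ hb v, integral_eq_lintegral_of_nonneg_ae]
  · congr 1
    refine lintegral_congr fun x => ?_
    rw [Real.enorm_eq_ofReal (mul_nonneg (collKernel_nonneg hb _ _) (maxwellian_pos _).le)]
  · exact .of_forall fun x => mul_nonneg (collKernel_nonneg hb _ _) (maxwellian_pos _).le
  · exact ((measurable_section (measurable_collKernel hb) v).mul
      (continuous_maxwellian.measurable.comp measurable_fst)).aestronglyMeasurable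

/-- Almost everywhere, the linear Boltzmann operator is the difference of gain and loss. -/
lemma linearBoltzmann_ae_eq (hd : 0 < d) (hγ : γ < 0) (hK : ∀ v : Vel d, collFreq γ v ≤ K)
    (hb : IsAngularKernel d b) {f : Vel d → ℝ} (hf : Measurable f) (hfi : Integrable f) :
    linearBoltzmann γ b f =ᵐ[volume]
      fun v => gainOp γ b f v - f v * (collFreq γ v).toReal := by
  filter_upwards [ae_integrable_gain hd hγ hK hb hf hfi] with v hv
  rw [linearBoltzmann, collision, gainOp, ← integral_loss hγ hb v, ← integral_const_mul,
    ← integral_sub hv ((integrable_loss hγ hK hb v).const_mul _)]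
  refine integral_congr_ae (.of_forall fun x => ?_)
  simp only [collKernel]
  ring

lemma stronglyMeasurable_gainOp (hb : IsAngularKernel d b) {f : Vel d → ℝ} (hf : Measurable f) :
    StronglyMeasurable (gainOp γ b f) :=
  (measurable_gainOp_integrand hb hf).stronglyMeasurable.integral_prod_right'

lemma enorm_gainOp_le (f : Vel d → ℝ) (v : Vel d) :
    ‖gainOp γ b f v‖ₑ ≤ ∫⁻ x : Vel d × Sph d, ‖collKernel γ b v x *
        (f (vPrime v x.1 x.2) * maxwellian d (vStarPrime v x.1 x.2))‖ₑ
        ∂((volume : Measure (Vel d)).prod (sphMeasure d)) :=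
  enorm_integral_le_lintegral_enorm _

lemma lintegral_enorm_gainOp_le (hd : 0 < d) (hγ : γ < 0) (hK : ∀ v : Vel d, collFreq γ v ≤ K)
    (hb : IsAngularKernel d b) {f : Vel d → ℝ} (hf : Measurable f) :
    ∫⁻ v, ‖gainOp γ b f v‖ₑ ≤ (∫⁻ v, ‖f v‖ₑ) * K :=
  (lintegral_mono (enorm_gainOp_le f)).trans ((lintegral_gain_eq hd hγ hb hf).le.trans
    (lintegral_mul_collFreq_le hK hf.enorm))

lemma integrable_gainOp (hd : 0 < d) (hγ : γ < 0) (hK : ∀ v : Vel d, collFreq γ v ≤ K)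
    (hb : IsAngularKernel d b) {f : Vel d → ℝ} (hf : Measurable f) (hfi : Integrable f) :
    Integrable (gainOp γ b f) :=
  ⟨(stronglyMeasurable_gainOp hb hf).aestronglyMeasurable,
    (lintegral_enorm_gainOp_le hd hγ hK hb hf).trans_lt
      (ENNReal.mul_lt_top hfi.2 ENNReal.coe_lt_top)⟩

lemma toReal_collFreq_le (hK : ∀ v : Vel d, collFreq γ v ≤ K) (v : Vel d) :
    (collFreq γ v).toReal ≤ K :=
  ENNReal.toReal_le_coe_of_le_coe (hK v)

lemma integrable_mul_collFreq (hK : ∀ v : Vel d, collFreq γ v ≤ K) {f : Vel d → ℝ}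
    (hfi : Integrable f) : Integrable fun v => f v * (collFreq γ v).toReal := by
  refine hfi.mul_bdd (c := K) measurable_collFreq.ennreal_toReal.aestronglyMeasurable
    (.of_forall fun v => ?_)
  rw [Real.norm_of_nonneg ENNReal.toReal_nonneg]
  exact toReal_collFreq_le hK v

lemma integrable_linearBoltzmann (hd : 0 < d) (hγ : γ < 0) (hK : ∀ v : Vel d, collFreq γ v ≤ K)
    (hb : IsAngularKernel d b) {f : Vel d → ℝ} (hf : Measurable f) (hfi : Integrable f) :
    Integrable (linearBoltzmann γ b f) :=
  ((integrable_gainOp hd hγ hK hb hf hfi).sub (integrable_mul_collFreq hK hfi)).congr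
    (linearBoltzmann_ae_eq hd hγ hK hb hf hfi).symm

lemma integral_norm_linearBoltzmann_le (hd : 0 < d) (hγ : γ < 0)
    (hK : ∀ v : Vel d, collFreq γ v ≤ K) (hb : IsAngularKernel d b) {f : Vel d → ℝ}
    (hf : Measurable f) (hfi : Integrable f) :
    ∫ v, ‖linearBoltzmann γ b f v‖ ≤ 2 * K * ∫ v, ‖f v‖ := by
  have h1 : ∫ v, ‖gainOp γ b f v‖ ≤ K * ∫ v, ‖f v‖ := by
    rw [integral_norm_eq_lintegral_enorm (stronglyMeasurable_gainOp hb hf).aestronglyMeasurable,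
      integral_norm_eq_lintegral_enorm hf.aestronglyMeasurable, mul_comm]
    have := ENNReal.toReal_mono (ENNReal.mul_ne_top hfi.2.ne ENNReal.coe_ne_top)
      (lintegral_enorm_gainOp_le hd hγ hK hb hf)
    rwa [ENNReal.toReal_mul, ENNReal.coe_toReal] at this
  have h2 : ∫ v, ‖f v * (collFreq γ v).toReal‖ ≤ K * ∫ v, ‖f v‖ := by
    rw [← integral_const_mul]
    refine integral_mono (integrable_mul_collFreq hK hfi).norm (hfi.norm.const_mul _) fun v => ?_
    simp only [norm_mul, Real.norm_of_nonneg ENNReal.toReal_nonneg, mul_comm (K : ℝ)]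
    exact mul_le_mul_of_nonneg_left (toReal_collFreq_le hK v) (norm_nonneg _)
  calc ∫ v, ‖linearBoltzmann γ b f v‖
      ≤ ∫ v, (‖gainOp γ b f v‖ + ‖f v * (collFreq γ v).toReal‖) := by
        refine integral_mono_ae (integrable_linearBoltzmann hd hγ hK hb hf hfi).norm
          ((integrable_gainOp hd hγ hK hb hf hfi).norm.add (integrable_mul_collFreq hK hfi).norm) ?_
        filter_upwards [linearBoltzmann_ae_eq hd hγ hK hb hf hfi] with v hv
        rw [hv]
        exact norm_sub_le _ _
    _ = (∫ v, ‖gainOp γ b f v‖) + ∫ v, ‖f v * (collFreq γ v).toReal‖ :=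
        integral_add (integrable_gainOp hd hγ hK hb hf hfi).norm
          (integrable_mul_collFreq hK hfi).norm
    _ ≤ _ := by linarith

/-- Null sets are not seen by the linear Boltzmann operator. -/
lemma linearBoltzmann_congr_ae (hd : 0 < d) (hγ : γ < 0) (hb : IsAngularKernel d b)
    {f g : Vel d → ℝ} (h : f =ᵐ[volume] g) :
    linearBoltzmann γ b f =ᵐ[volume] linearBoltzmann γ b g := by
  obtain ⟨s, hs, hsm, hs0⟩ := exists_measurable_superset_of_null (ae_iff.1 h)
  set ι : Vel d → ℝ := s.indicator 1 with hι
  have hιm : Measurable ι := measurable_one.indicator hsm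
  have hm := (measurable_gainOp_integrand (γ := γ) hb hιm).enorm
  -- By the mass balance the gain of a null set vanishes. Hence for almost every `v`, almost every
  -- collision either has zero kernel or sends $v'$ outside the exceptional set.
  have h0 : ∫⁻ v, ∫⁻ x : Vel d × Sph d, ‖collKernel γ b v x *
        (ι (vPrime v x.1 x.2) * maxwellian d (vStarPrime v x.1 x.2))‖ₑ
        ∂((volume : Measure (Vel d)).prod (sphMeasure d)) = 0 := by
    rw [lintegral_gain_eq hd hγ hb hιm, lintegral_eq_zero_iff (by fun_prop)]
    have : ∀ᵐ v : Vel d, v ∉ s := by simpa [ae_iff] using hs0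
    filter_upwards [this] with v hv
    simp [hι, hv]
  rw [lintegral_eq_zero_iff hm.lintegral_prod_right'] at h0
  filter_upwards [h0, h] with v hv hfg
  have hmv : Measurable fun x : Vel d × Sph d => ‖collKernel γ b v x *
        (ι (vPrime v x.1 x.2) * maxwellian d (vStarPrime v x.1 x.2))‖ₑ :=
    measurable_section hm v
  rw [Pi.zero_apply, lintegral_eq_zero_iff hmv] at hv
  refine integral_congr_ae ?_
  filter_upwards [hv] with x hx
  rw [hfg]
  simp only [Pi.zero_apply, enorm_eq_zero, mul_eq_zero, (maxwellian_pos _).ne', or_false] at hx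
  rcases hx with hx | hx
  · have : ‖v - x.1‖ ^ γ * b (cosTheta v x.1 x.2) = 0 := hx
    rw [this, zero_mul, zero_mul]
  · have : vPrime v x.1 x.2 ∉ s := by
      intro hmem
      simp [hι, hmem] at hx
    have : f (vPrime v x.1 x.2) = g (vPrime v x.1 x.2) := by
      by_contra hne
      exact this (hs hne)
    rw [this]

lemma gainOp_linear_ae (hd : 0 < d) (hγ : γ < 0) (hK : ∀ v : Vel d, collFreq γ v ≤ K)
    (hb : IsAngularKernel d b) {f g : Vel d → ℝ} (hf : Measurable f) (hfi : Integrable f)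
    (hg : Measurable g) (hgi : Integrable g) (a : ℝ) :
    gainOp γ b (fun v => a * f v + g v) =ᵐ[volume]
      fun v => a * gainOp γ b f v + gainOp γ b g v := by
  filter_upwards [ae_integrable_gain hd hγ hK hb hf hfi,
    ae_integrable_gain hd hγ hK hb hg hgi] with v h1 h2
  rw [gainOp, gainOp, gainOp, ← integral_const_mul, ← integral_add (h1.const_mul a) h2]
  refine integral_congr_ae (.of_forall fun x => ?_)
  simp only
  ring

lemma linearBoltzmann_linear_ae (hd : 0 < d) (hγ : γ < 0) (hK : ∀ v : Vel d, collFreq γ v ≤ K)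
    (hb : IsAngularKernel d b) {f g : Vel d → ℝ} (hf : Measurable f) (hfi : Integrable f)
    (hg : Measurable g) (hgi : Integrable g) (a : ℝ) :
    linearBoltzmann γ b (fun v => a * f v + g v) =ᵐ[volume]
      fun v => a * linearBoltzmann γ b f v + linearBoltzmann γ b g v := by
  filter_upwards [gainOp_linear_ae hd hγ hK hb hf hfi hg hgi a,
    linearBoltzmann_ae_eq hd hγ hK hb hf hfi, linearBoltzmann_ae_eq hd hγ hK hb hg hgi,
    linearBoltzmann_ae_eq hd hγ hK hb (f := fun v => a * f v + g v)
      ((hf.const_mul a).add hg) ((hfi.const_mul a).add hgi)]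
    with v h1 h2 h3 h4
  rw [h2, h3, h4, h1]
  ring

/-- The linear Boltzmann operator is a bounded operator on `L¹`. -/
lemma exists_linearBoltzmann_clm (hd : 0 < d) (hγ : γ < 0)
    (hK : ∀ v : Vel d, collFreq γ v ≤ K) (hb : IsAngularKernel d b) :
    ∃ L : Lp ℝ 1 (volume : Measure (Vel d)) →L[ℝ] Lp ℝ 1 (volume : Measure (Vel d)),
      ∀ F, L F =ᵐ[volume] linearBoltzmann γ b F := by
  have hi : ∀ F : Lp ℝ 1 (volume : Measure (Vel d)), Integrable (linearBoltzmann γ b F) :=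
    fun F => integrable_linearBoltzmann hd hγ hK hb (Lp.stronglyMeasurable F).measurable
      (L1.integrable_coeFn F)
  have hlin : ∀ (a : ℝ) (F G : Lp ℝ 1 (volume : Measure (Vel d))),
      linearBoltzmann γ b (a • F + G : Lp ℝ 1 (volume : Measure (Vel d))) =ᵐ[volume]
        fun v => a * linearBoltzmann γ b F v + linearBoltzmann γ b G v := by
    intro a F G
    have h1 : (a • F + G : Lp ℝ 1 (volume : Measure (Vel d))) =ᵐ[volume]
        fun v => a * F v + G v := by
      filter_upwards [Lp.coeFn_add (a • F) G, Lp.coeFn_smul a F] with v h1 h2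
      rw [h1, Pi.add_apply, h2, Pi.smul_apply, smul_eq_mul]
    exact (linearBoltzmann_congr_ae hd hγ hb h1).trans (linearBoltzmann_linear_ae hd hγ hK hb
      (Lp.stronglyMeasurable F).measurable (L1.integrable_coeFn F)
      (Lp.stronglyMeasurable G).measurable (L1.integrable_coeFn G) a)
  have hzero : linearBoltzmann γ b (0 : Lp ℝ 1 (volume : Measure (Vel d))) =ᵐ[volume] 0 := by
    -- Affine combination with $a=-1$ at zero gives $L0=-L0+L0=0$.
    have := hlin (-1) 0 0
    rw [smul_zero, add_zero] at this
    filter_upwards [this] with v hv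
    rw [hv]
    simp
  let L₀ : Lp ℝ 1 (volume : Measure (Vel d)) →ₗ[ℝ] Lp ℝ 1 (volume : Measure (Vel d)) :=
    { toFun := fun F => (hi F).toL1 _
      map_add' := fun F G => by
        rw [← Integrable.toL1_add, Integrable.toL1_eq_toL1_iff]
        have := hlin 1 F G
        rw [one_smul] at this
        filter_upwards [this] with v hv
        rw [hv]
        simp
      map_smul' := fun a F => by
        rw [RingHom.id_apply, ← Integrable.toL1_smul, Integrable.toL1_eq_toL1_iff]
        have := hlin a F 0
        rw [add_zero] at this
        filter_upwards [this, hzero] with v hv hz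
        rw [hv, hz]
        simp }
  refine ⟨L₀.mkContinuous (2 * K) fun F => ?_, fun F => ?_⟩
  · change ‖(hi F).toL1 _‖ ≤ _
    rw [L1.norm_of_fun_eq_integral_norm, L1.norm_eq_integral_norm]
    exact integral_norm_linearBoltzmann_le hd hγ hK hb (Lp.stronglyMeasurable F).measurable
      (L1.integrable_coeFn F)
  · exact (hi F).coeFn_toL1

end Operator

/-! ### Dissipation of the truncated functional. -/

section Dissipation

variable {d : ℕ} {γ p n : ℝ} {b : ℝ → ℝ}

/-- Absorption of the regularising part of the gain term. -/
lemma exists_scale (hp : 1 < p) (A K : ℝ≥0) {X : ℝ} (hX : 0 ≤ X) :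
    ∃ h : ℝ, 0 < h ∧ h * A * X ≤ 1 / 8 ∧
      h ^ (-(p - 1)) * K * X ≤ K * (8 * (A + 1)) ^ (p - 1) * X ^ p := by
  -- For zero mass any `h` will do. Otherwise `h` is proportional to $1/X$, so that $h^{-(p-1)}X$
  -- scales like $X^p$; `A + 1` keeps the denominator positive when `A = 0`.
  rcases hX.eq_or_lt with rfl | hX0
  · exact ⟨1, one_pos, by simp, by simp [Real.zero_rpow (by linarith : p ≠ 0)]⟩
  · have hA : (0 : ℝ) ≤ A := A.2
    refine ⟨(8 * (A + 1) * X)⁻¹, by positivity, ?_, ?_⟩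
    · rw [mul_assoc, inv_mul_le_iff₀ (by positivity)]
      nlinarith
    · rw [Real.rpow_neg (by positivity), Real.inv_rpow (by positivity), inv_inv,
        Real.mul_rpow (by positivity) hX, rpow_eq_mul_rpow_sub_one hp hX]
      exact le_of_eq (by ring)

lemma integrable_truncDeriv_mul (hp : 1 < p) (hn : 0 < n) {f g : Vel d → ℝ}
    (hf : AEStronglyMeasurable f) (hg : Integrable g) :
    Integrable fun v => truncDeriv p n (f v) * g v := by
  refine hg.bdd_mul (c := p * n ^ (p - 1))
    ((continuous_truncDeriv hp).comp_aestronglyMeasurable hf) (.of_forall fun v => ?_)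
  rw [Real.norm_of_nonneg (truncDeriv_nonneg hp hn _)]
  exact truncDeriv_le hp hn _

/-- `exists_gainForm_le` with the Young pair of the truncated power: the scale `h` makes the regular
part at most $1/8$ of the $G$ term, so the coefficient of the loss becomes exactly `1`, with no
dependence on `n`. -/
lemma gain_le_loss_add (hd : 0 < d) (hγd : -(d : ℝ) < γ) (hγ : γ < 0) (hp : 1 < p) :
    ∃ C : ℝ≥0, ∀ b : ℝ → ℝ, IsAngularKernel d b → ∀ n : ℝ, 0 < n → ∀ f : Vel d → ℝ,
      Measurable f → Integrable f → (∀ v, 0 ≤ f v) →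
      gainForm γ 1 (fun s => ENNReal.ofReal (b s))
        (fun x y => ‖truncDeriv p n (f x)‖ₑ * ‖f y‖ₑ) ≤
        (∫⁻ v, ENNReal.ofReal (truncDeriv p n (f v) * f v) * collFreq γ v) +
          ENNReal.ofReal (C * (∫ v, f v) ^ p) := by
  obtain ⟨A, K, hAK⟩ := exists_gainForm_le (γ := γ) hd hγd hγ
  refine ⟨K * (8 * (A + 1)) ^ (p - 1), fun b hb n hn f hf hfi hf0 => ?_⟩
  have hX0 : 0 ≤ ∫ v, f v := integral_nonneg hf0
  obtain ⟨h, hh0, hh1, hh2⟩ := exists_scale hp A K hX0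
  have hcP := (continuous_truncPow (n := n) hp).measurable
  have hcD := (continuous_truncDeriv (n := n) hp).measurable
  have hcT := (continuous_trunc (n := n)).measurable
  set β : Vel d → ℝ≥0∞ := fun v => ENNReal.ofReal (truncPow p n (f v)) with hβ
  set G : Vel d → ℝ≥0∞ := fun v => ENNReal.ofReal ((p - 1) * trunc n (f v) ^ p) with hG
  have hβm : Measurable β := (hcP.comp hf).ennreal_ofReal
  have hGm : Measurable G := (((hcT.comp hf).pow_const p).const_mul _).ennreal_ofReal
  have hG0 : ∀ s, 0 ≤ (p - 1) * trunc n s ^ p := fun s =>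
    mul_nonneg (by linarith) (Real.rpow_nonneg (trunc_nonneg hn s) _)
  have hX : ∫⁻ v, ‖f v‖ₑ = ENNReal.ofReal (∫ v, f v) := by
    rw [ofReal_integral_eq_lintegral_ofReal hfi (.of_forall hf0)]
    exact lintegral_congr fun v => Real.enorm_eq_ofReal (hf0 v)
  have key := hAK b hb (fun v => ‖f v‖ₑ) (fun v => ‖truncDeriv p n (f v)‖ₑ) β G hf.enorm
    (hcD.comp hf).enorm hβm hGm ?_ (ENNReal.ofReal h) (ENNReal.ofReal (h ^ (-(p - 1)))) ?_
  · have hS : (∫⁻ v, ENNReal.ofReal (truncDeriv p n (f v) * f v) * collFreq γ v) =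
        (∫⁻ v, β v * collFreq γ v) + ∫⁻ v, G v * collFreq γ v := by
      rw [← lintegral_add_left (f := fun v => β v * collFreq γ v) (by fun_prop)]
      refine lintegral_congr fun v => ?_
      rw [← add_mul, hβ, hG, ← ENNReal.ofReal_add (truncPow_nonneg hp hn (hf0 v)) (hG0 _),
        truncPow_add hp hn]
    rw [hS]
    refine key.trans ?_
    rw [hX]
    set Iβ := ∫⁻ v, β v * collFreq γ v
    set IG := ∫⁻ v, G v * collFreq γ v
    have e1 : ENNReal.ofReal h * A * ENNReal.ofReal (∫ v, f v) ≤ 1 / 8 := by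
      rw [← ENNReal.ofReal_coe_nnreal, ← ENNReal.ofReal_mul hh0.le,
        ← ENNReal.ofReal_mul (by positivity)]
      refine (ENNReal.ofReal_le_ofReal hh1).trans ?_
      rw [← ENNReal.toReal_le_toReal (by finiteness) (by finiteness)]
      norm_num
    have e2 : ENNReal.ofReal (h ^ (-(p - 1))) * K * ENNReal.ofReal (∫ v, f v) ≤
        ENNReal.ofReal ((K * (8 * (A + 1)) ^ (p - 1) : ℝ≥0) * (∫ v, f v) ^ p) := by
      rw [← ENNReal.ofReal_coe_nnreal (p := K), ← ENNReal.ofReal_mul (by positivity),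
        ← ENNReal.ofReal_mul (by positivity)]
      refine ENNReal.ofReal_le_ofReal (hh2.trans (le_of_eq ?_))
      push_cast
      ring
    refine add_le_add ?_ e2
    calc _ ≤ 7 / 8 * (Iβ + IG) + 1 / 8 * IG := by gcongr
      _ ≤ 7 / 8 * (Iβ + IG) + 1 / 8 * (Iβ + IG) := by gcongr; exact le_add_self
      _ = (7 / 8 + 1 / 8) * (Iβ + IG) := by ring
      _ = Iβ + IG := by
        have : (7 / 8 + 1 / 8 : ℝ≥0∞) = 1 := by
          rw [← ENNReal.toReal_eq_toReal_iff' (by finiteness) (by finiteness),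
            ENNReal.toReal_add (by finiteness) (by finiteness)]
          norm_num
        rw [this, one_mul]
  · intro x y
    rw [Real.enorm_eq_ofReal (truncDeriv_nonneg hp hn _), Real.enorm_eq_ofReal (hf0 y),
      ← ENNReal.ofReal_mul (truncDeriv_nonneg hp hn _), hβ, hG,
      ← ENNReal.ofReal_add (truncPow_nonneg hp hn (hf0 y)) (hG0 _)]
    exact ENNReal.ofReal_le_ofReal (truncDeriv_mul_le hp hn _ (hf0 y))
  · intro x
    rw [Real.enorm_eq_ofReal (truncDeriv_nonneg hp hn _), hG, ← ENNReal.ofReal_mul hh0.le,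
      ← ENNReal.ofReal_add (mul_nonneg hh0.le (hG0 _)) (Real.rpow_nonneg hh0.le _)]
    exact ENNReal.ofReal_le_ofReal (truncDeriv_le_add hp hn hh0 _)

/-- The dissipation of the truncated `Lᵖ` functional along the linear Boltzmann operator. -/
theorem exists_integral_truncDeriv_le (hd : 0 < d) (hγd : -(d : ℝ) < γ) (hγ : γ < 0)
    (hp : 1 < p) :
    ∃ C : ℝ≥0, ∀ b : ℝ → ℝ, IsAngularKernel d b → ∀ n : ℝ, 0 < n → ∀ f : Vel d → ℝ,
      Integrable f → (∀ᵐ v, 0 ≤ f v) →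
      ∫ v, truncDeriv p n (f v) * linearBoltzmann γ b f v ≤ C * (∫ v, f v) ^ p := by
  obtain ⟨C, hC⟩ := gain_le_loss_add (γ := γ) hd hγd hγ hp
  obtain ⟨K, hK⟩ := exists_collFreq_le hd hγd hγ
  refine ⟨C, fun b hb n hn => ?_⟩
  have main : ∀ f : Vel d → ℝ, Measurable f → Integrable f → (∀ v, 0 ≤ f v) →
      ∫ v, truncDeriv p n (f v) * linearBoltzmann γ b f v ≤ C * (∫ v, f v) ^ p := by
    intro f hf hfi hf0
    have hg := integrable_gainOp hd hγ hK hb hf hfi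
    have hl := integrable_mul_collFreq hK hfi
    have hfm := hf.aestronglyMeasurable (μ := volume)
    have e1 : ∫ v, truncDeriv p n (f v) * linearBoltzmann γ b f v =
        (∫ v, truncDeriv p n (f v) * gainOp γ b f v) -
          ∫ v, truncDeriv p n (f v) * (f v * (collFreq γ v).toReal) := by
      rw [← integral_sub (integrable_truncDeriv_mul hp hn hfm hg)
        (integrable_truncDeriv_mul hp hn hfm hl)]
      refine integral_congr_ae ?_
      filter_upwards [linearBoltzmann_ae_eq hd hγ hK hb hf hfi] with v hv
      rw [hv, mul_sub]
    set Λ := ∫⁻ v, ENNReal.ofReal (truncDeriv p n (f v) * f v) * collFreq γ v with hΛ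
    have hfin : ∀ v : Vel d, collFreq γ v ≠ ∞ := fun v =>
      ne_top_of_le_ne_top ENNReal.coe_ne_top (hK v)
    have hΛe : ENNReal.ofReal (∫ v, truncDeriv p n (f v) * (f v * (collFreq γ v).toReal)) = Λ := by
      rw [ofReal_integral_eq_lintegral_ofReal (integrable_truncDeriv_mul hp hn hfm hl)
        (.of_forall fun v => mul_nonneg (truncDeriv_nonneg hp hn _)
          (mul_nonneg (hf0 v) ENNReal.toReal_nonneg))]
      refine lintegral_congr fun v => ?_
      rw [← mul_assoc, ENNReal.ofReal_mul (mul_nonneg (truncDeriv_nonneg hp hn _) (hf0 v)),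
        ENNReal.ofReal_toReal (hfin v)]
    have hgain : ENNReal.ofReal (∫ v, truncDeriv p n (f v) * gainOp γ b f v) ≤
        Λ + ENNReal.ofReal (C * (∫ v, f v) ^ p) := by
      refine le_trans ?_ (hC b hb n hn f hf hfi hf0)
      rw [gainForm_eq hb hf]
      calc _ ≤ ‖∫ v, truncDeriv p n (f v) * gainOp γ b f v‖ₑ := by
            rw [← ofReal_norm]
            exact ENNReal.ofReal_le_ofReal (le_abs_self _)
        _ ≤ ∫⁻ v, ‖truncDeriv p n (f v) * gainOp γ b f v‖ₑ := enorm_integral_le_lintegral_enorm _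
        _ ≤ _ := by
            refine lintegral_mono fun v => ?_
            rw [enorm_mul]
            gcongr
            exact enorm_gainOp_le f v
    have hC0 : 0 ≤ C * (∫ v, f v) ^ p :=
      mul_nonneg C.2 (Real.rpow_nonneg (integral_nonneg hf0) _)
    have hI0 : 0 ≤ ∫ v, truncDeriv p n (f v) * (f v * (collFreq γ v).toReal) :=
      integral_nonneg fun v => mul_nonneg (truncDeriv_nonneg hp hn _)
          (mul_nonneg (hf0 v) ENNReal.toReal_nonneg)
    rw [← hΛe, ← ENNReal.ofReal_add hI0 hC0,
      ENNReal.ofReal_le_ofReal_iff (add_nonneg hI0 hC0)] at hgain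
    rw [e1]
    linarith
  intro f hfi hf0
  -- A representative that is measurable and non-negative everywhere; the operator ignores the null
  -- set where it differs from `f`.
  set g : Vel d → ℝ := fun v => max (hfi.1.mk f v) 0 with hg
  have hgm : Measurable g := hfi.1.stronglyMeasurable_mk.measurable.max measurable_const
  have hfg : f =ᵐ[volume] g := by
    filter_upwards [hfi.1.ae_eq_mk, hf0] with v h1 h2
    rw [hg]
    simp only
    rw [← h1, max_eq_left h2]
  have h1 := main g hgm (hfi.congr hfg) fun v => le_max_right _ _
  rw [integral_congr_ae hfg]
  refine le_trans (le_of_eq (integral_congr_ae ?_)) h1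
  filter_upwards [hfg, linearBoltzmann_congr_ae hd hγ hb hfg] with v e1 e2
  rw [e1, e2]

end Dissipation

/-! ### From dissipation to the growth of the $L^p$ norm along mild solutions. -/

section Evolution

variable {d : ℕ} {γ p n : ℝ} {b : ℝ → ℝ}

/-- The truncated `Lᵖ` functional `∫ truncPow(F)`. -/
def truncFunctional (p n : ℝ) (F : Lp ℝ 1 (volume : Measure (Vel d))) : ℝ :=
  ∫ v, truncPow p n (F v)

lemma integrable_truncPow (hp : 1 < p) (hn : 0 < n) {F : Vel d → ℝ} (hF : Integrable F)
    (hF0 : ∀ᵐ v, 0 ≤ F v) : Integrable fun v => truncPow p n (F v) := by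
  refine (hF.const_mul (p * n ^ (p - 1))).mono
    ((continuous_truncPow hp).comp_aestronglyMeasurable hF.1) ?_
  filter_upwards [hF0] with v hv
  have h := truncPow_le_mul (n := n) hp hn hv
  rw [Real.norm_of_nonneg (truncPow_nonneg hp hn hv)]
  exact h.trans (le_abs_self _)

lemma truncFunctional_sub_le (hp : 1 < p) (hn : 0 < n)
    {F G : Lp ℝ 1 (volume : Measure (Vel d))} (hF : ∀ᵐ v, 0 ≤ F v) (hG : ∀ᵐ v, 0 ≤ G v) :
    truncFunctional p n F - truncFunctional p n G ≤
      ∫ v, truncDeriv p n (F v) * (F - G : Lp ℝ 1 (volume : Measure (Vel d))) v := by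
  have hFi := L1.integrable_coeFn F
  have hGi := L1.integrable_coeFn G
  rw [truncFunctional, truncFunctional, ← integral_sub (integrable_truncPow hp hn hFi hF)
    (integrable_truncPow hp hn hGi hG)]
  refine integral_mono_ae ((integrable_truncPow hp hn hFi hF).sub
    (integrable_truncPow hp hn hGi hG))
    (integrable_truncDeriv_mul hp hn hFi.1 (L1.integrable_coeFn _)) ?_
  filter_upwards [hF, hG, Lp.coeFn_sub F G] with v h1 h2 h3
  rw [h3]
  exact truncPow_sub_le hp hn h2 _

lemma integral_truncDeriv_mul_le (hp : 1 < p) (hn : 0 < n)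
    (F G : Lp ℝ 1 (volume : Measure (Vel d))) :
    ∫ v, truncDeriv p n (F v) * G v ≤ p * n ^ (p - 1) * ‖G‖ := by
  have hG := L1.integrable_coeFn G
  rw [L1.norm_eq_integral_norm, ← integral_const_mul]
  refine integral_mono (integrable_truncDeriv_mul hp hn (L1.integrable_coeFn F).1 hG)
    (hG.norm.const_mul _) fun v => ?_
  calc truncDeriv p n (F v) * G v ≤ truncDeriv p n (F v) * ‖G v‖ :=
        mul_le_mul_of_nonneg_left (le_abs_self _) (truncDeriv_nonneg hp hn _)
    _ ≤ _ := mul_le_mul_of_nonneg_right (truncDeriv_le hp hn _) (norm_nonneg _)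

lemma integral_truncDeriv_mul_add (hp : 1 < p) (hn : 0 < n)
    (F G H : Lp ℝ 1 (volume : Measure (Vel d))) :
    ∫ v, truncDeriv p n (F v) * (G + H : Lp ℝ 1 (volume : Measure (Vel d))) v =
      (∫ v, truncDeriv p n (F v) * G v) + ∫ v, truncDeriv p n (F v) * H v := by
  rw [← integral_add (integrable_truncDeriv_mul hp hn (L1.integrable_coeFn F).1
    (L1.integrable_coeFn G)) (integrable_truncDeriv_mul hp hn (L1.integrable_coeFn F).1
    (L1.integrable_coeFn H))]
  refine integral_congr_ae ?_
  filter_upwards [Lp.coeFn_add G H] with v hv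
  rw [hv, Pi.add_apply, mul_add]

lemma integral_truncDeriv_mul_smul (F G : Lp ℝ 1 (volume : Measure (Vel d))) (c : ℝ) :
    ∫ v, truncDeriv p n (F v) * (c • G : Lp ℝ 1 (volume : Measure (Vel d))) v =
      c * ∫ v, truncDeriv p n (F v) * G v := by
  rw [← integral_const_mul]
  refine integral_congr_ae ?_
  filter_upwards [Lp.coeFn_smul c G] with v hv
  rw [hv, Pi.smul_apply, smul_eq_mul]
  ring

lemma abs_truncFunctional_sub_le (hp : 1 < p) (hn : 0 < n)
    {F G : Lp ℝ 1 (volume : Measure (Vel d))} (hF : ∀ᵐ v, 0 ≤ F v) (hG : ∀ᵐ v, 0 ≤ G v) :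
    |truncFunctional p n F - truncFunctional p n G| ≤ p * n ^ (p - 1) * ‖F - G‖ := by
  have h1 := (truncFunctional_sub_le (n := n) hp hn hF hG).trans
    (integral_truncDeriv_mul_le hp hn F _)
  have h2 := (truncFunctional_sub_le (n := n) hp hn hG hF).trans
    (integral_truncDeriv_mul_le hp hn G _)
  rw [norm_sub_rev] at h2
  rw [abs_le]
  constructor <;> linarith

lemma norm_eq_integral_of_nonneg {F : Lp ℝ 1 (volume : Measure (Vel d))} (hF : ∀ᵐ v, 0 ≤ F v) :
    ‖F‖ = ∫ v, F v := by
  rw [L1.norm_eq_integral_norm]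
  refine integral_congr_ae ?_
  filter_upwards [hF] with v hv
  exact Real.norm_of_nonneg hv

/-- Growth of the truncated functional along a non-negative mild solution. -/
lemma truncFunctional_le (hp : 1 < p) (hn : 0 < n) {C : ℝ≥0}
    (L : Lp ℝ 1 (volume : Measure (Vel d)) →L[ℝ] Lp ℝ 1 (volume : Measure (Vel d)))
    (hL : ∀ F : Lp ℝ 1 (volume : Measure (Vel d)), (∀ᵐ v, 0 ≤ F v) →
      ∫ v, truncDeriv p n (F v) * L F v ≤ C * ‖F‖ ^ p)
    {f : ℝ → Lp ℝ 1 (volume : Measure (Vel d))} (hf : Continuous f)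
    (hf0 : ∀ t, ∀ᵐ v, 0 ≤ f t v)
    (heq : ∀ t, 0 ≤ t → f t = f 0 + L (∫ τ in (0 : ℝ)..t, f τ)) {t : ℝ} (ht : 0 ≤ t) :
    truncFunctional p n (f t) ≤
      truncFunctional p n (f 0) + ∫ τ in (0 : ℝ)..t, C * ‖f τ‖ ^ p := by
  set M := p * n ^ (p - 1) with hM
  have hcn : Continuous fun τ => C * ‖f τ‖ ^ p :=
    continuous_const.mul (hf.norm.rpow_const fun _ => Or.inr (by linarith))
  have hJ : Continuous fun τ => truncFunctional p n (f τ) := by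
    rw [continuous_iff_continuousAt]
    intro s
    rw [ContinuousAt, tendsto_iff_norm_sub_tendsto_zero]
    have h1 : Tendsto (fun τ => M * ‖f τ - f s‖) (𝓝 s) (𝓝 0) := by
      have := (tendsto_iff_norm_sub_tendsto_zero.1 (hf.tendsto s)).const_mul M
      simpa using this
    exact squeeze_zero (fun _ => norm_nonneg _)
      (fun τ => abs_truncFunctional_sub_le hp hn (hf0 τ) (hf0 s)) h1
  -- The functional is only known to be continuous in time, so the growth bound comes from its right
  -- difference quotients rather than from a chain rule.
  refine image_le_of_liminf_slope_right_le_deriv_boundary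
    (f := fun τ => truncFunctional p n (f τ)) (a := 0) (b := t)
    (B := fun s => truncFunctional p n (f 0) + ∫ τ in (0 : ℝ)..s, C * ‖f τ‖ ^ p)
    (B' := fun s => C * ‖f s‖ ^ p) hJ.continuousOn (by simp) ?_ ?_ ?_ (right_mem_Icc.2 ht)
  · exact (continuous_const.add (intervalIntegral.continuous_primitive
      (fun _ _ => hcn.intervalIntegrable _ _) 0)).continuousOn
  · intro s _
    exact ((hcn.integral_hasStrictDerivAt 0 s).hasDerivAt.const_add _).hasDerivWithinAt
  · intro s hs r hr
    set g : ℝ → Lp ℝ 1 (volume : Measure (Vel d)) :=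
      fun z => f 0 + L (∫ τ in (0 : ℝ)..z, f τ) with hg
    have hgd : HasDerivAt g (L (f s)) s := by
      have h1 := (hf.integral_hasStrictDerivAt 0 s).hasDerivAt
      exact (L.hasFDerivAt.comp_hasDerivAt s h1).const_add _
    have hslope : Tendsto (slope g s) (𝓝[>] s) (𝓝 (L (f s))) :=
      (hasDerivAt_iff_tendsto_slope.1 hgd).mono_left (nhdsWithin_mono _ fun z hz => ne_of_gt hz)
    have hbound : Tendsto (fun z => C * ‖f z‖ ^ p + M * ‖slope g s z - L (f z)‖) (𝓝[>] s)
        (𝓝 (C * ‖f s‖ ^ p)) := by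
      have h1 : Tendsto (fun z => C * ‖f z‖ ^ p) (𝓝[>] s) (𝓝 (C * ‖f s‖ ^ p)) :=
        (hcn.tendsto s).mono_left nhdsWithin_le_nhds
      have h2 : Tendsto (fun z => L (f z)) (𝓝[>] s) (𝓝 (L (f s))) :=
        ((L.continuous.comp hf).tendsto s).mono_left nhdsWithin_le_nhds
      have h3 := ((hslope.sub h2).norm).const_mul M
      rw [sub_self, norm_zero, mul_zero] at h3
      simpa using h1.add h3
    refine Eventually.frequently ?_
    filter_upwards [hbound.eventually_lt_const hr, self_mem_nhdsWithin] with z hz hzs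
    refine lt_of_le_of_lt ?_ hz
    have hzs' : 0 < z - s := sub_pos.2 hzs
    -- Convexity places the derivative at the later state `f z`, so the increment is compared with
    -- `L (f z)`, where the dissipation bound applies; the remainder tends to zero in $L^1$ while
    -- the derivative is bounded by `M`.
    have e1 : f z - f s = (z - s) • (L (f z) + (slope g s z - L (f z))) := by
      rw [add_sub_cancel, slope_def_module, smul_smul, mul_inv_cancel₀ hzs'.ne', one_smul,
        heq z (hs.1.trans (le_of_lt hzs)), heq s hs.1]
    have e2 := truncFunctional_sub_le (n := n) hp hn (hf0 z) (hf0 s)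
    rw [e1, integral_truncDeriv_mul_smul, integral_truncDeriv_mul_add hp hn] at e2
    have e3 := hL (f z) (hf0 z)
    have e4 := integral_truncDeriv_mul_le hp hn (f z) (slope g s z - L (f z))
    rw [slope_def_field, div_le_iff₀' hzs']
    refine e2.trans (mul_le_mul_of_nonneg_left ?_ hzs'.le)
    linarith

/-- The weight $\langle v\rangle^k$ is at least `1` for $k\ge0$. -/
lemma ofReal_norm_le_moment {k : ℝ} (hk : 0 ≤ k) {F : Lp ℝ 1 (volume : Measure (Vel d))}
    (hF : ∀ᵐ v, 0 ≤ F v) : ENNReal.ofReal ‖F‖ ≤ moment k F := by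
  rw [norm_eq_integral_of_nonneg hF,
    ofReal_integral_eq_lintegral_ofReal (L1.integrable_coeFn F) hF, moment]
  refine lintegral_mono_ae ?_
  filter_upwards [hF] with v hv
  refine ENNReal.ofReal_le_ofReal (le_mul_of_one_le_left hv ?_)
  refine Real.one_le_rpow ?_ hk
  rw [Real.one_le_sqrt]
  linarith [sq_nonneg ‖v‖]

lemma eLpNorm_rpow_eq (hp : 1 < p) (f : Vel d → ℝ) :
    eLpNorm f (ENNReal.ofReal p) volume ^ p = ∫⁻ v, ‖f v‖ₑ ^ p := by
  have hp0 : 0 < p := by linarith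
  rw [eLpNorm_eq_lintegral_rpow_enorm_toReal (by simpa using hp0) ENNReal.ofReal_ne_top,
    ENNReal.toReal_ofReal hp0.le, ← ENNReal.rpow_mul, one_div_mul_cancel hp0.ne',
    ENNReal.rpow_one]

/-- The `Lᵖ` norm is bounded by any common bound of the truncated functionals. -/
lemma eLpNorm_rpow_le_of_truncFunctional_le (hp : 1 < p)
    {F : Lp ℝ 1 (volume : Measure (Vel d))} (hF : ∀ᵐ v, 0 ≤ F v) {B : ℝ≥0∞}
    (hB : ∀ n : ℝ, 0 < n → ENNReal.ofReal (truncFunctional p n F) ≤ B) :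
    eLpNorm F (ENNReal.ofReal p) volume ^ p ≤ B := by
  rw [eLpNorm_rpow_eq hp]
  have hFm := (Lp.stronglyMeasurable F).measurable
  -- The shift by one keeps the threshold positive for every `k`.
  set T : ℕ → Vel d → ℝ≥0∞ := fun k v => ENNReal.ofReal (trunc ((k : ℝ) + 1) (F v) ^ p) with hT
  have hTm : ∀ k, Measurable (T k) := fun k =>
    ((continuous_trunc.measurable.comp hFm).pow_const p).ennreal_ofReal
  calc ∫⁻ v, ‖F v‖ₑ ^ p ≤ ∫⁻ v, liminf (fun k => T k v) atTop := by
        refine lintegral_mono_ae ?_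
        filter_upwards [hF] with v hv
        have : ∀ᶠ k : ℕ in atTop, T k v = ‖F v‖ₑ ^ p := by
          filter_upwards [eventually_ge_atTop ⌈F v⌉₊] with k hk
          have h1 : F v ≤ (k : ℝ) + 1 := (Nat.ceil_le.1 hk).trans (by linarith)
          rw [hT]
          simp only
          rw [trunc, max_eq_left hv, min_eq_left h1, Real.enorm_eq_ofReal hv,
            ENNReal.ofReal_rpow_of_nonneg hv (by linarith)]
        rw [liminf_congr this]
        simp
    _ ≤ liminf (fun k => ∫⁻ v, T k v) atTop := lintegral_liminf_le hTm
    _ ≤ B := by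
        refine liminf_le_of_frequently_le' (Frequently.of_forall fun k => ?_)
        have hk : (0 : ℝ) < (k : ℝ) + 1 := by positivity
        refine le_trans ?_ (hB _ hk)
        rw [truncFunctional, ofReal_integral_eq_lintegral_ofReal
          (integrable_truncPow hp hk (L1.integrable_coeFn F) hF)]
        · refine lintegral_mono_ae ?_
          filter_upwards [hF] with v hv
          exact ENNReal.ofReal_le_ofReal (trunc_rpow_le_truncPow hp hk hv)
        · filter_upwards [hF] with v hv
          exact truncPow_nonneg hp hk hv

lemma ofReal_truncFunctional_le (hp : 1 < p) (hn : 0 < n)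
    {F : Lp ℝ 1 (volume : Measure (Vel d))} (hF : ∀ᵐ v, 0 ≤ F v) :
    ENNReal.ofReal (truncFunctional p n F) ≤ eLpNorm F (ENNReal.ofReal p) volume ^ p := by
  rw [eLpNorm_rpow_eq hp, truncFunctional, ofReal_integral_eq_lintegral_ofReal
    (integrable_truncPow hp hn (L1.integrable_coeFn F) hF)]
  · refine lintegral_mono_ae ?_
    filter_upwards [hF] with v hv
    rw [Real.enorm_eq_ofReal hv, ENNReal.ofReal_rpow_of_nonneg hv (by linarith)]
    exact ENNReal.ofReal_le_ofReal (truncPow_le_rpow hp hn hv)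
  · filter_upwards [hF] with v hv
    exact truncPow_nonneg hp hn hv

/-- The `Lᵖ` estimate for non-negative mild solutions, in terms of any moment of non-negative
order. -/
theorem exists_eLpNorm_le (hd : 0 < d) (hγd : -(d : ℝ) < γ) (hγ : γ < 0) (hp : 1 < p) :
    ∃ C : ℝ≥0, ∀ b : ℝ → ℝ, IsAngularKernel d b →
      ∀ (f₀ : Vel d → ℝ) (f : ℝ → Lp ℝ 1 (volume : Measure (Vel d))),
        IsMildSolution γ b f₀ f → (∀ t : ℝ, 0 ≤ t → ∀ᵐ v, 0 ≤ f t v) →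
        ∀ k : ℝ, 0 ≤ k → ∀ t : ℝ, 0 ≤ t →
          eLpNorm (f t) (ENNReal.ofReal p) volume ^ p ≤
            eLpNorm f₀ (ENNReal.ofReal p) volume ^ p +
              C * ∫⁻ τ in Set.Icc (0 : ℝ) t, moment k (f τ) ^ p := by
  obtain ⟨C, hC⟩ := exists_integral_truncDeriv_le (γ := γ) hd hγd hγ hp
  obtain ⟨K, hK⟩ := exists_collFreq_le hd hγd hγ
  refine ⟨C, fun b hb f₀ f hf hf0 k hk t ht => ?_⟩
  obtain ⟨L, hL⟩ := exists_linearBoltzmann_clm hd hγ hK hb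
  -- Freezing the solution at negative times gives a function continuous on the whole line, with the
  -- same values and integrals for non-negative times.
  set g : ℝ → Lp ℝ 1 (volume : Measure (Vel d)) := fun s => f (max s 0) with hg
  have hgf : ∀ s, 0 ≤ s → g s = f s := fun s hs => by rw [hg]; simp only [max_eq_left hs]
  have hgc : Continuous g := hf.continuousOn.comp_continuous (by fun_prop) fun s => le_max_right s 0
  have hg0 : ∀ s, ∀ᵐ v, 0 ≤ g s v := fun s => hf0 _ (le_max_right s 0)
  have heq : ∀ s, 0 ≤ s → g s = g 0 + L (∫ τ in (0 : ℝ)..s, g τ) := by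
    intro s hs
    have hint : ∫ τ in (0 : ℝ)..s, g τ = ∫ τ in (0 : ℝ)..s, f τ := by
      refine intervalIntegral.integral_congr fun τ hτ => ?_
      rw [uIcc_of_le hs] at hτ
      exact hgf τ hτ.1
    rw [hint, hgf s hs, hgf 0 le_rfl]
    refine Lp.ext ?_
    filter_upwards [hf.equation s hs, hf.initial, hL (∫ τ in (0 : ℝ)..s, f τ),
      Lp.coeFn_add (f 0) (L (∫ τ in (0 : ℝ)..s, f τ))] with v h1 h2 h3 h4
    rw [h1, h4, Pi.add_apply, h2, h3]
  have hLn : ∀ n : ℝ, 0 < n → ∀ F : Lp ℝ 1 (volume : Measure (Vel d)), (∀ᵐ v, 0 ≤ F v) →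
      ∫ v, truncDeriv p n (F v) * L F v ≤ C * ‖F‖ ^ p := by
    intro n hn F hF
    rw [norm_eq_integral_of_nonneg hF]
    refine le_trans (le_of_eq (integral_congr_ae ?_)) (hC b hb n hn F (L1.integrable_coeFn F) hF)
    filter_upwards [hL F] with v hv
    rw [hv]
  have hcn : Continuous fun τ => C * ‖g τ‖ ^ p :=
    continuous_const.mul (hgc.norm.rpow_const fun _ => Or.inr (by linarith))
  have htime : ENNReal.ofReal (∫ τ in (0 : ℝ)..t, C * ‖g τ‖ ^ p) ≤
      C * ∫⁻ τ in Set.Icc (0 : ℝ) t, moment k (f τ) ^ p := by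
    rw [intervalIntegral.integral_of_le ht, ← integral_Icc_eq_integral_Ioc,
      ofReal_integral_eq_lintegral_ofReal hcn.continuousOn.integrableOn_Icc
        (.of_forall fun τ => mul_nonneg C.2 (Real.rpow_nonneg (norm_nonneg _) _)),
      ← lintegral_const_mul' _ _ ENNReal.coe_ne_top]
    refine setLIntegral_mono' measurableSet_Icc fun τ hτ => ?_
    rw [ENNReal.ofReal_mul (NNReal.coe_nonneg C), ENNReal.ofReal_coe_nnreal,
      ← ENNReal.ofReal_rpow_of_nonneg (norm_nonneg _) (by linarith), ← hgf τ hτ.1]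
    gcongr
    exact ofReal_norm_le_moment hk (hg0 τ)
  have hinit : eLpNorm (g 0) (ENNReal.ofReal p) volume = eLpNorm f₀ (ENNReal.ofReal p) volume := by
    rw [hgf 0 le_rfl]
    exact eLpNorm_congr_ae hf.initial
  rw [← hgf t ht]
  refine eLpNorm_rpow_le_of_truncFunctional_le hp (hg0 t) fun n hn => ?_
  calc ENNReal.ofReal (truncFunctional p n (g t))
      ≤ ENNReal.ofReal (truncFunctional p n (g 0) + ∫ τ in (0 : ℝ)..t, C * ‖g τ‖ ^ p) :=
        ENNReal.ofReal_le_ofReal (truncFunctional_le hp hn L (hLn n hn) hgc hg0 heq ht)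
    _ ≤ ENNReal.ofReal (truncFunctional p n (g 0)) +
          ENNReal.ofReal (∫ τ in (0 : ℝ)..t, C * ‖g τ‖ ^ p) := ENNReal.ofReal_add_le
    _ ≤ _ := by
        rw [← hinit]
        exact add_le_add (ofReal_truncFunctional_le hp hn (hg0 0)) htime

lemma etaBound_pos {a : ℝ} (hp : 1 < p) (ha : 0 < a) : 0 < etaBound p a := by
  unfold etaBound
  positivity

lemma eta0_pos (hd : 0 < d) (hγd : -(d : ℝ) < γ) (hp : 1 < p) : 0 < eta0 d γ p := by
  have h1 : 0 < p - 1 := by linarith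
  have h2 : 0 < 1 + γ / d := by
    have : (0 : ℝ) < d := by exact_mod_cast hd
    have : -1 < γ / d := by rw [lt_div_iff₀ this]; linarith
    linarith
  have hm : 0 < min (p - 1) (min (etaBound p (p - 1)) (etaBound p (1 + γ / d))) :=
    lt_min h1 (lt_min (etaBound_pos hp h1) (etaBound_pos hp h2))
  unfold eta0
  simp only
  split_ifs with h
  · exact lt_min hm (div_pos (by positivity) (by linarith))
  · exact hm

lemma eta0_le : eta0 d γ p ≤ p - 1 := by
  unfold eta0
  simp only
  split_ifs with h
  · exact (min_le_left _ _).trans (min_le_left _ _)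
  · exact min_le_left _ _

lemma momentOrder_nonneg {η : ℝ} (hη : 0 < η) (h : η < eta0 d γ p) : 0 ≤ momentOrder γ p η := by
  have : η < p - 1 := h.trans_le eta0_le
  exact mul_nonneg (by positivity) (le_max_of_le_left (by linarith))

/-- The first entry of the maximum already suffices for small $\eta$: $|\gamma|(p-1-\eta)>\eta$
exactly when $\eta<|\gamma|(p-1)/(1+|\gamma|)$. -/
lemma exists_one_lt_momentOrder (hd : 0 < d) (hγd : -(d : ℝ) < γ) (hγ : γ < 0) (hp : 1 < p) :
    ∃ η : ℝ, 0 < η ∧ η < eta0 d γ p ∧ 1 < momentOrder γ p η := by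
  have h0 := eta0_pos hd hγd hp
  have h1 : 0 < p - 1 := by linarith
  have hg : 0 < |γ| := abs_pos.2 hγ.ne
  set η₁ := |γ| * (p - 1) / (1 + |γ|) with hη₁
  have hη₁0 : 0 < η₁ := by positivity
  obtain ⟨η, hη0, hη⟩ := exists_between (lt_min h0 hη₁0)
  refine ⟨η, hη0, hη.trans_le (min_le_left _ _), ?_⟩
  have h2 : η < η₁ := hη.trans_le (min_le_right _ _)
  rw [hη₁, lt_div_iff₀ (by positivity)] at h2
  refine lt_of_lt_of_le ?_ (mul_le_mul_of_nonneg_left (le_max_left _ _) (by positivity))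
  rw [div_mul_eq_mul_div, lt_div_iff₀ hη0]
  linarith

end Evolution

end LinearBoltzmann

end

theorem theorem2p7 (d : ℕ) (γ p : ℝ) (hγd : -(d : ℝ) < γ) (hγ : γ < 0) (hp : 1 < p) :
    (∃ η : ℝ, 0 < η ∧ η < eta0 d γ p ∧ 1 < momentOrder γ p η) ∧
    ∀ η : ℝ, 0 < η → η < eta0 d γ p →
      ∃ C : NNReal, ∀ b : ℝ → ℝ, IsAngularKernel d b →
        ∀ (f₀ : Vel d → ℝ) (f : ℝ → Lp ℝ 1 (volume : Measure (Vel d))),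
          MemLp f₀ 1 volume → MemLp f₀ (ENNReal.ofReal p) volume →
          IsMildSolution γ b f₀ f →
          (∀ t : ℝ, 0 ≤ t → ∀ᵐ v, 0 ≤ f t v) →
          ∀ t : ℝ, 0 ≤ t →
            eLpNorm (f t) (ENNReal.ofReal p) volume ^ p ≤
              eLpNorm f₀ (ENNReal.ofReal p) volume ^ p +
                C * ∫⁻ τ in Set.Icc (0 : ℝ) t, moment (momentOrder γ p η) (f τ) ^ p := by
  -- For `d = 0` the condition $-d<\gamma<0$ is empty.
  have hd : 0 < d := by
    rcases Nat.eq_zero_or_pos d with rfl | h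
    · norm_num at hγd
      linarith
    · exact h
  refine ⟨exists_one_lt_momentOrder hd hγd hγ hp, fun η hη0 hη => ?_⟩
  obtain ⟨C, hC⟩ := exists_eLpNorm_le hd hγd hγ hp
  -- The parameter $\eta$ enters only through the non-negativity of the moment order, so the same
  -- `C` serves every $\eta$.
  exact ⟨C, fun b hb f₀ f _ _ hf hf0 t ht =>
    hC b hb f₀ f hf hf0 _ (momentOrder_nonneg hη0 hη) t ht⟩
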